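/- Let $(\mathbf X,\mathcal B(\mathbf X))$ be a standard Borel space, let $T_0\in\mathbb R$ and $T_0<T_1\le+\infty$. Let $q(x,t,B)$, $x\in\mathbf X$, $t\in[T_0,T_1[$, $B\in\mathcal B(\mathbf X)$, be a conservative $Q$-function, that is: for all $x,t$ the function $q(x,t,\cdot)$ is a finite signed measure with $q(x,t,\mathbf X)=0$ and $q(x,t,B\setminus\{x\})\ge 0$ for all $B\in\mathcal B(\mathbf X)$, and for every $B$ the function $q(x,t,B)$ is measurable in $(x,t)$. Put $q(x,t):=q(x,t,\mathbf X\setminus\{x\})$, and assume that $\sup_{t\in[T_0,T_1[}q(x,t)<\infty$ for each $x\in\mathbf X$. A set $B\in\mathcal B(\mathbf X)$ is called $q$-bounded if $q(y,t)$ is bounded on $B\times[T_0,T_1[$. For $x\in\mathbf X$, $u\in[T_0,T_1[$, $t\in]u,T_1[$ and $B\in\mathcal B(\mathbf X)$ let $$\bar P^{(0)}(u,x;t,B):=I\{x\in B\}\,e^{-\int_u^t q(x,s)\,ds},$$ $$\bar P^{(n)}(u,x;t,B):=\int_u^t\int_{\mathbf X}e^{-\int_u^w q(x,\theta)\,d\theta}\,\bar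 P^{(n-1)}(w,y;t,B)\,q(x,w,dy\setminus\{x\})\,dw,\qquad n\ge 1,$$ where $q(x,w,dy\setminus\{x\})$ denotes the measure $B\mapsto q(x,w,B\setminus\{x\})$, and $\bar P(u,x;t,B):=\sum_{n\ge 0}\bar P^{(n)}(u,x;t,B)$. Fix $x\in\mathbf X$ and write $\bar P(t,B):=\bar P(T_0,x;t,B)$ for $t\in]T_0,T_1[$ and $B\in\mathcal B(\mathbf X)$. Consider the equation $$P(t,B)=I\{x\in B\}+\int_{T_0}^t ds\int_{\mathbf X}q(y,s,B\setminus\{y\})\,P(s,dy)-\int_{T_0}^t ds\int_B q(y,s)\,P(s,dy), \tag{1}$$ where "$P$ satisfies (1)" includes that all three quantities $P(t,B)$ and the two integrals are finite. Let $\mathcal S$ be the set of all functions $P(t,B)\in[0,\infty]$, $t\in]T_0,T_1[$, $B\in\mathcal B(\mathbf X)$, that are measures on $(\mathbf X,\mathcal B(\mathbf X))$ for fixed $t$, are measurable in $t$ for fixed $B$, and satisfy (1) for all $t\in]T_0,T_1[$ and all $q$-bounded sets $B$. Then: (a) $\bar P(t,B)$ satisfies (1) for all $t\in]T_0,T_1[$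 and all $q$-bounded sets $B$. (b) $\bar P$ takes values in $[0,1]$ and is the minimal element of $\mathcal S$: $\bar P\in\mathcal S$, and $\bar P(t,B)\le P(t,B)$ for all $P\in\mathcal S$, $t\in]T_0,T_1[$ and $B\in\mathcal B(\mathbf X)$. In addition, if $\bar P(t,\mathbf X)=1$ for all $t\in]T_0,T_1[$, then $\bar P$ is the unique element of $\mathcal S$ with values in $[0,1]$. -/

import Mathlib

open MeasureTheory Set
open scoped ENNReal

namespace JumpMarkov

/-- The time interval `[T₀, T₁[`, where `T₀` is real and `T₁ ≤ +∞`. -/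
def timeDomain (T₀ : ℝ) (T₁ : EReal) : Set ℝ := {t | T₀ ≤ t ∧ (t : EReal) < T₁}

/-- The open time interval `]T₀, T₁[`. -/
def openTimeDomain (T₀ : ℝ) (T₁ : EReal) : Set ℝ := {t | T₀ < t ∧ (t : EReal) < T₁}

variable {X : Type*} [MeasurableSpace X]

/-- `q(x,t,B)` is a conservative `Q`-function on `[T₀, T₁[`. Values of `q` at times outside
`[T₀, T₁[` are irrelevant. A conservative `Q`-function has finite values
(`q(x,t,{x}) = -q(x,t,X \ {x})`), so real-valued signed measures lose nothing. -/
structure IsConservativeQFunction (T₀ : ℝ) (T₁ : EReal) (q : X → ℝ → SignedMeasure X) :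
    Prop where
  nonneg_off_diag : ∀ x, ∀ t ∈ timeDomain T₀ T₁, ∀ B, MeasurableSet B → 0 ≤ q x t (B \ {x})
  conservative : ∀ x, ∀ t ∈ timeDomain T₀ T₁, q x t univ = 0
  measurable : ∀ B, MeasurableSet B →
    Measurable fun p : X × timeDomain T₀ T₁ => q p.1 (p.2 : ℝ) B

/-- The jump rate `q(x,t) = q(x,t,X \ {x})`. -/
noncomputable def rate (q : X → ℝ → SignedMeasure X) (x : X) (t : ℝ) : ℝ :=
  q x t (univ \ {x})

/-- For each state the jump rate is bounded in time:
`sup {q(x,t) | t ∈ [T₀, T₁[} < ∞` for each `x`. -/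
def BoundedRates (T₀ : ℝ) (T₁ : EReal) (q : X → ℝ → SignedMeasure X) : Prop :=
  ∀ x, BddAbove (rate q x '' timeDomain T₀ T₁)

/-- `B` is a `q`-bounded set: it is measurable and `q(y,t)` is bounded on `B × [T₀, T₁[`. -/
def IsQBounded (T₀ : ℝ) (T₁ : EReal) (q : X → ℝ → SignedMeasure X) (B : Set X) : Prop :=
  MeasurableSet B ∧ ∃ K : ℝ, ∀ y ∈ B, ∀ t ∈ timeDomain T₀ T₁, rate q y t ≤ K

open Classical in
/-- The measure `B ↦ q(x,t,B \ {x})`. It is the zero measure where this set function is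
not nonnegative, which does not happen for a `Q`-function and `t ∈ [T₀, T₁[`. -/
noncomputable def jumpMeasure [MeasurableSingletonClass X] (q : X → ℝ → SignedMeasure X)
    (x : X) (t : ℝ) : Measure X :=
  if h : VectorMeasure.restrict 0 {x}ᶜ ≤ VectorMeasure.restrict (q x t) {x}ᶜ then
    (q x t).toMeasureOfZeroLE {x}ᶜ (MeasurableSet.singleton x).compl h
  else 0

theorem jumpMeasure_apply [MeasurableSingletonClass X] {T₀ : ℝ} {T₁ : EReal}
    {q : X → ℝ → SignedMeasure X} (hq : IsConservativeQFunction T₀ T₁ q) (x : X) {t : ℝ}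
    (ht : t ∈ timeDomain T₀ T₁) {B : Set X} (hB : MeasurableSet B) :
    jumpMeasure q x t B = ENNReal.ofReal (q x t (B \ {x})) := by
  have h : VectorMeasure.restrict 0 {x}ᶜ ≤ VectorMeasure.restrict (q x t) {x}ᶜ := by
    refine VectorMeasure.restrict_le_restrict_of_subset_le _ _ fun C hC hCx => ?_
    have h0 := hq.nonneg_off_diag x t ht C hC
    have hCd : C \ {x} = C :=
      sdiff_eq_left.2 (disjoint_left.2 fun y hy hyx => hCx hy hyx)
    simpa [hCd] using h0
  have hset : {x}ᶜ ∩ B = B \ {x} := by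
    ext y; simp [and_comm]
  rw [jumpMeasure, dif_pos h, SignedMeasure.toMeasureOfZeroLE_apply _ h _ hB,
    ENNReal.ofReal_eq_coe_nnreal (hq.nonneg_off_diag x t ht B hB)]
  simp only [hset]

/-- The terms `P̄⁽ⁿ⁾(u,x;t,B)` of Feller's series. -/
noncomputable def fellerTerm [MeasurableSingletonClass X] (q : X → ℝ → SignedMeasure X) :
    ℕ → ℝ → X → ℝ → Set X → ℝ≥0∞
  | 0, u, x, t, B =>
      B.indicator (fun _ => ENNReal.ofReal (Real.exp (-∫ s in u..t, rate q x s))) x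
  | n + 1, u, x, t, B =>
      ∫⁻ w in Ioo u t, ∫⁻ y,
        ENNReal.ofReal (Real.exp (-∫ θ in u..w, rate q x θ)) * fellerTerm q n w y t B
          ∂(jumpMeasure q x w)

/-- Feller's function `P̄(u,x;t,B) = ∑ₙ P̄⁽ⁿ⁾(u,x;t,B)`, the transition function of the jump
Markov process defined by `q`. -/
noncomputable def fellerTransition [MeasurableSingletonClass X]
    (q : X → ℝ → SignedMeasure X) (u : ℝ) (x : X) (t : ℝ) (B : Set X) : ℝ≥0∞ :=
  ∑' n, fellerTerm q n u x t B

/-- `∫_{T₀}^t ds ∫_X q(y,s,B \ {y}) P(s,dy)`. -/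
noncomputable def inflow (T₀ : ℝ) (q : X → ℝ → SignedMeasure X) (P : ℝ → Measure X)
    (t : ℝ) (B : Set X) : ℝ≥0∞ :=
  ∫⁻ s in Ioo T₀ t, ∫⁻ y, ENNReal.ofReal (q y s (B \ {y})) ∂(P s)

/-- `∫_{T₀}^t ds ∫_B q(y,s) P(s,dy)`. -/
noncomputable def outflow (T₀ : ℝ) (q : X → ℝ → SignedMeasure X) (P : ℝ → Measure X)
    (t : ℝ) (B : Set X) : ℝ≥0∞ :=
  ∫⁻ s in Ioo T₀ t, ∫⁻ y in B, ENNReal.ofReal (rate q y s) ∂(P s)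

/-- The integral forward equation at `(t,B)` for a process started at `x` at time `T₀`. All its
terms are required to be finite, so that the right-hand side is not `∞ - ∞`. -/
def ForwardEquation (T₀ : ℝ) (q : X → ℝ → SignedMeasure X) (x : X) (P : ℝ → Measure X)
    (t : ℝ) (B : Set X) : Prop :=
  P t B < ∞ ∧ inflow T₀ q P t B < ∞ ∧ outflow T₀ q P t B < ∞ ∧
    (P t B).toReal = B.indicator (fun _ => (1 : ℝ)) x
      + (inflow T₀ q P t B).toReal - (outflow T₀ q P t B).toReal

/-- `P(t,B)`, `t ∈ ]T₀, T₁[`, is a measure-valued solution of the integral forward equation: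
it is a measure in `B`, measurable in `t`, and satisfies the equation for all
`t ∈ ]T₀, T₁[` and all `q`-bounded sets `B`. Values of `P` outside `]T₀, T₁[` are irrelevant. -/
structure IsForwardSolution (T₀ : ℝ) (T₁ : EReal) (q : X → ℝ → SignedMeasure X) (x : X)
    (P : ℝ → Measure X) : Prop where
  measurable : ∀ B, MeasurableSet B →
    Measurable fun t : openTimeDomain T₀ T₁ => P (t : ℝ) B
  equation : ∀ t ∈ openTimeDomain T₀ T₁, ∀ B, IsQBounded T₀ T₁ q B →
    ForwardEquation T₀ q x P t B

end JumpMarkov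

/-! The argument follows the measure `Γ` on time × state that counts the entries of the jump process
into states, the start included. `stateAt` weights each entry by the probability that the state is
kept until `t`. The `n`-th Feller term is the state distribution at `t` between jumps `n` and `n +
1`, so Feller's function is `stateAt` of `allJumps`.

Existence. An entry into `B` before `t` is either still in force at `t` or ended before `t`: 1 =
exp(-∫r) + ∫ r exp(-∫r), decomposed by the first jump. Integrated against `Γ` this gives `P(t,B) +
outflow = Γ(]-∞,t[ × B)` (`stateAt_add_outflow`). Since `Γ` is the start plus all jumps
(`allJumps_eq`), the right side is the indicator plus the inflow. Everything is kept additive in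
`[0,∞]` and called `Balanced`; subtraction appears only where finiteness is known. The total mass is
at most 1 by telescoping over the number of jumps.

Minimality. For a solution `P`, let `N` (`entries`) be the start plus the jumps made out of `P`. On
a `q`-bounded set the equation expresses `P` through `N`, and integration against the decomposition
by the last event before `t` (variation of constants) yields `P = stateAt N` there, after cancelling
the finite outflow (`stateAt_add_outflow_of_balanced`). A countable cover by `q`-bounded sets
extends this to the whole space. Hence `N` is the start plus the image of `N` under one next jump;
iterating, `N` dominates the sum of all jump generations, and `stateAt` is monotone.

The cover is the delicate point: a supremum of rates over uncountably many times, with rates merely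
measurable in time, need not be Borel in the state. Its superlevel sets are analytic and decrease to
the empty set, so Novikov's separation theorem supplies Borel sets around them with empty
intersection. -/

namespace JumpMarkov

/-! ### Novikov separation and countable measurable covers -/

/-- Dependent recursion along finite prefixes: a property of the first `m` coordinates of a
sequence which can always be extended by one coordinate holds along some sequence. -/
theorem exists_seq_forall_prefix (p : (ℕ → ℕ) → ℕ → Prop)
    (hp : ∀ z z' m, (∀ k < m, z k = z' k) → p z m → p z' m) (z₀ : ℕ → ℕ) (h0 : p z₀ 0)
    (hstep : ∀ z m, p z m → ∃ j, p (Function.update z m j) (m + 1)) :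
    ∃ z, ∀ m, p z m := by
  choose! J hJ using hstep
  let s : ℕ → ℕ → ℕ := fun m => Nat.rec z₀ (fun m z => Function.update z m (J z m)) m
  have hs : ∀ m, s (m + 1) = Function.update (s m) m (J (s m) m) := fun m => rfl
  have hps : ∀ m, p (s m) m := by
    intro m
    induction m with
    | zero => exact h0
    | succ m ih => rw [hs]; exact hJ _ _ ih
  have hstab : ∀ k d, s (k + 1 + d) k = s (k + 1) k := by
    intro k d
    induction d with
    | zero => rfl
    | succ d ih =>
      rw [← add_assoc, hs, Function.update_of_ne (by omega), ih]
  refine ⟨fun k => s (k + 1) k, fun m => hp _ _ m (fun k hk => ?_) (hps m)⟩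
  obtain ⟨d, rfl⟩ := Nat.exists_eq_add_of_le (Nat.succ_le_of_lt hk)
  exact hstab k d

section Separation

variable {α : Type*} [MeasurableSpace α]

/-- A sequence of sets is jointly separable if it can be enlarged to a sequence of measurable sets
with empty intersection. -/
def JointlySeparable (s : ℕ → Set α) : Prop :=
  ∃ u : ℕ → Set α, (∀ n, s n ⊆ u n) ∧ (∀ n, MeasurableSet (u n)) ∧ ⋂ n, u n = ∅

/-- From separations `u j` of the modified sequences, take the union over `j` at index `i` and the
intersection over `j` elsewhere: a common point would lie in `u j i` for some `j`, hence in every `u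
j n` for that same `j`. -/
theorem JointlySeparable.of_iUnion {s : ℕ → Set α} (i : ℕ) {c : ℕ → Set α} (hc : s i ⊆ ⋃ j, c j)
    (h : ∀ j, JointlySeparable (Function.update s i (c j))) : JointlySeparable s := by
  choose u hsu hu hemp using h
  refine ⟨Function.update (fun n => ⋂ j, u j n) i (⋃ j, u j i), fun n => ?_, fun n => ?_, ?_⟩
  · rcases eq_or_ne n i with rfl | hn
    · rw [Function.update_self]
      refine hc.trans (iUnion_mono fun j => ?_)
      simpa using hsu j n
    · rw [Function.update_of_ne hn]
      refine subset_iInter fun j => ?_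
      simpa [Function.update_of_ne hn] using hsu j n
  · rcases eq_or_ne n i with rfl | hn
    · rw [Function.update_self]
      exact MeasurableSet.iUnion fun j => hu j n
    · rw [Function.update_of_ne hn]
      exact MeasurableSet.iInter fun j => hu j n
  · refine eq_empty_of_forall_notMem fun x hx => ?_
    rw [mem_iInter] at hx
    have hxi := hx i
    rw [Function.update_self, mem_iUnion] at hxi
    obtain ⟨j, hj⟩ := hxi
    have : x ∈ ⋂ n, u j n := mem_iInter.2 fun n => by
      rcases eq_or_ne n i with rfl | hn
      · exact hj
      · have := hx n
        rw [Function.update_of_ne hn] at this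
        exact mem_iInter.1 this j
    rw [hemp j] at this
    exact this

theorem JointlySeparable.mono {s t : ℕ → Set α} (hst : ∀ n, s n ⊆ t n) (h : JointlySeparable t) :
    JointlySeparable s :=
  let ⟨u, h1, h2, h3⟩ := h
  ⟨u, fun n => (hst n).trans (h1 n), h2, h3⟩

/-- If the ranges were inseparable, inseparability would survive fixing one coordinate of one
parameter at a time, by countable subdivision. In the limit every `f n` has a single parameter `y
n`. The values cannot all agree, and disjoint neighbourhoods of two different values separate the
images at a finite stage. -/
theorem jointlySeparable_range [TopologicalSpace α] [T2Space α] [OpensMeasurableSpace α]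
    {f : ℕ → (ℕ → ℕ) → α} (hf : ∀ n, Continuous (f n)) (h : ⋂ n, range (f n) = ∅) :
    JointlySeparable fun n => range (f n) := by
  by_contra hsep
  -- The single sequence `z` interleaves all parameters: entry `Nat.pair n k` prescribes coordinate
  -- `k` of the argument of `f n`, and at stage `m` only entries below `m` are active.
  let A : (ℕ → ℕ) → ℕ → ℕ → Set α := fun z m n =>
    f n '' {y | ∀ k, Nat.pair n k < m → y k = z (Nat.pair n k)}
  obtain ⟨z, hz⟩ := exists_seq_forall_prefix (fun z m => ¬ JointlySeparable (A z m))
    (fun z z' m hzz' hzm => by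
      have : A z m = A z' m := by
        funext n
        refine congrArg (f n '' ·) (Set.ext fun y => forall_congr' fun k => ?_)
        exact imp_congr_right fun hk => by rw [hzz' _ hk]
      rwa [← this]) 0
    (by simpa [A] using hsep)
    (fun z m hzm => by
      by_contra! hcon
      refine hzm (JointlySeparable.of_iUnion m.unpair.1
        (c := fun j => A (Function.update z m j) (m + 1) m.unpair.1) ?_ fun j => ?_)
      · rintro _ ⟨y, hy, rfl⟩
        refine mem_iUnion.2 ⟨y m.unpair.2, y, fun k hk => ?_, rfl⟩
        rcases (Nat.lt_succ_iff_lt_or_eq.1 hk) with hk | hk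
        · rw [Function.update_of_ne hk.ne]; exact hy k hk
        · rw [hk, Function.update_self, ← hk, Nat.unpair_pair]
      · refine JointlySeparable.mono (fun n => ?_) (hcon j)
        rcases eq_or_ne n m.unpair.1 with rfl | hn
        · rw [Function.update_self]
        · rw [Function.update_of_ne hn]
          refine image_mono fun y hy k hk => ?_
          have hkm : Nat.pair n k ≠ m := fun hkm => hn (by rw [← hkm, Nat.unpair_pair])
          rw [Function.update_of_ne hkm]
          exact hy k (by omega))
  let y : ℕ → ℕ → ℕ := fun n k => z (Nat.pair n k)
  have hne : ∃ i, f i (y i) ≠ f 0 (y 0) := by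
    by_contra! hcon
    have : f 0 (y 0) ∈ ⋂ n, range (f n) := mem_iInter.2 fun n => ⟨y n, hcon n⟩
    rw [h] at this
    exact this
  obtain ⟨i, hi⟩ := hne
  obtain ⟨U, V, hU, hV, hiU, h0V, hUV⟩ := t2_separation hi
  have hcyl : ∀ n (W : Set α), IsOpen W → f n (y n) ∈ W → ∃ N, ∀ m, N ≤ m → A z m n ⊆ W := by
    intro n W hW hnW
    obtain ⟨_, ⟨x, l, rfl⟩, hyx, hsub⟩ := (PiNat.isTopologicalBasis_cylinders
      (E := fun _ => ℕ)).mem_nhds_iff.1 ((hW.preimage (hf n)).mem_nhds hnW)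
    refine ⟨Nat.pair n l, fun m hm => ?_⟩
    rintro _ ⟨v, hv, rfl⟩
    refine hsub ?_
    rw [PiNat.mem_cylinder_iff_eq.1 hyx |>.symm]
    intro k hk
    exact hv k ((Nat.pair_lt_pair_right n hk).trans_le hm)
  obtain ⟨N, hN⟩ := hcyl i U hU hiU
  obtain ⟨N', hN'⟩ := hcyl 0 V hV h0V
  have hi0 : i ≠ 0 := by rintro rfl; exact hi rfl
  refine hz (max N N') ⟨Function.update (Function.update (fun _ => univ) i U) 0 V, ?_, ?_, ?_⟩
  · intro n
    rcases eq_or_ne n 0 with rfl | hn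
    · rw [Function.update_self]; exact hN' _ (le_max_right _ _)
    · rw [Function.update_of_ne hn]
      rcases eq_or_ne n i with rfl | hn
      · rw [Function.update_self]; exact hN _ (le_max_left _ _)
      · rw [Function.update_of_ne hn]; exact subset_univ _
  · intro n
    rcases eq_or_ne n 0 with rfl | hn
    · rw [Function.update_self]; exact hV.measurableSet
    · rw [Function.update_of_ne hn]
      rcases eq_or_ne n i with rfl | hn
      · rw [Function.update_self]; exact hU.measurableSet
      · rw [Function.update_of_ne hn]; exact MeasurableSet.univ
  · refine eq_empty_of_forall_notMem fun x hx => ?_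
    have h1 := mem_iInter.1 hx 0
    have h2 := mem_iInter.1 hx i
    rw [Function.update_self] at h1
    rw [Function.update_of_ne hi0, Function.update_self] at h2
    exact disjoint_left.1 hUV h2 h1

/-- **Novikov's separation theorem**: a sequence of analytic sets with empty intersection can be
enlarged to a sequence of Borel sets with empty intersection. -/
theorem jointlySeparable_of_analyticSet [TopologicalSpace α] [T2Space α] [OpensMeasurableSpace α]
    {s : ℕ → Set α} (hs : ∀ n, AnalyticSet (s n)) (h : ⋂ n, s n = ∅) : JointlySeparable s := by
  by_cases hemp : ∃ n, s n = ∅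
  · obtain ⟨n, hn⟩ := hemp
    refine ⟨Function.update (fun _ => univ) n ∅, fun k => ?_, fun k => ?_, ?_⟩
    · rcases eq_or_ne k n with rfl | hk
      · rw [Function.update_self, hn]
      · rw [Function.update_of_ne hk]; exact subset_univ _
    · rcases eq_or_ne k n with rfl | hk
      · rw [Function.update_self]; exact MeasurableSet.empty
      · rw [Function.update_of_ne hk]; exact MeasurableSet.univ
    · refine subset_empty_iff.1 (iInter_subset_of_subset n ?_)
      rw [Function.update_self]
  · push Not at hemp
    have : ∀ n, ∃ f : (ℕ → ℕ) → α, Continuous f ∧ range f = s n := fun n => by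
      have := hs n
      rw [AnalyticSet] at this
      exact this.resolve_left (hemp n).ne_empty
    choose f hf hfs using this
    have hs' : s = fun n => range (f n) := funext fun n => (hfs n).symm
    subst hs'
    exact jointlySeparable_range hf h

/-- A measurable function on a product of standard Borel spaces which is bounded on each section
`{y | (y, x)}` is bounded uniformly in `x` on each member of a countable measurable cover. -/
theorem exists_measurable_cover_of_bounded_sections {X Y : Type*} [MeasurableSpace X]
    [StandardBorelSpace X] [MeasurableSpace Y] [StandardBorelSpace Y] {r : Y × X → ℝ≥0∞}
    (hr : Measurable r) (hb : ∀ x, ∃ c : ℕ, ∀ y, r (y, x) ≤ c) :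
    ∃ A : ℕ → Set X, (∀ n, MeasurableSet (A n)) ∧ (∀ n, ∀ x ∈ A n, ∀ y, r (y, x) ≤ n) ∧
      ⋃ n, A n = univ := by
  let := upgradeStandardBorel X
  -- The states whose section exceeds `n` somewhere form the projection of a Borel set, hence an
  -- analytic set; bounded sections make the intersection over `n` empty.
  obtain ⟨u, hsu, hu, hemp⟩ := jointlySeparable_of_analyticSet
    (s := fun n : ℕ => Prod.snd '' {p : Y × X | (n : ℝ≥0∞) < r p})
    (fun n => (measurableSet_lt measurable_const hr).analyticSet_image measurable_snd)
    (by
      refine eq_empty_of_forall_notMem fun x hx => ?_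
      obtain ⟨c, hc⟩ := hb x
      obtain ⟨⟨y, x'⟩, hy, rfl⟩ := mem_iInter.1 hx c
      exact absurd (hc y) (not_le.2 hy))
  refine ⟨fun n => (u n)ᶜ, fun n => (hu n).compl, fun n x hx y => ?_, ?_⟩
  · by_contra! hlt
    exact hx (hsu n ⟨(y, x), hlt, rfl⟩)
  · rw [← compl_iInter, hemp, compl_empty]

end Separation

/-! ### Survival probabilities for a bounded measurable rate -/

/-- The probability `exp (-∫_u^t r)` that no event of rate `r` happens between `u` and `t`. -/
noncomputable def survival (r : ℝ → ℝ≥0∞) (u t : ℝ) : ℝ≥0∞ :=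
  ENNReal.ofReal (Real.exp (-∫ s in u..t, (r s).toReal))

theorem survival_ne_top (r : ℝ → ℝ≥0∞) (u t : ℝ) : survival r u t ≠ ∞ :=
  ENNReal.ofReal_ne_top

theorem measurable_survival {X Z : Type*} [MeasurableSpace X] [MeasurableSpace Z]
    {r : ℝ × X → ℝ≥0∞} (hr : Measurable r) {x : Z → X} {u t : Z → ℝ} (hx : Measurable x)
    (hu : Measurable u) (ht : Measurable t) :
    Measurable fun z => survival (fun s => r (s, x z)) (u z) (t z) := by
  have key : ∀ a b : Z → ℝ, Measurable a → Measurable b →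
      Measurable fun z => ∫ s in Ioc (a z) (b z), (r (s, x z)).toReal := by
    intro a b ha hb
    have : ∀ z, ∫ s in Ioc (a z) (b z), (r (s, x z)).toReal =
        ∫ s, {p : Z × ℝ | a p.1 < p.2 ∧ p.2 ≤ b p.1}.indicator
          (fun p => (r (p.2, x p.1)).toReal) (z, s) := fun z => by
      rw [← integral_indicator measurableSet_Ioc]
      rfl
    simp_rw [this]
    refine StronglyMeasurable.measurable (StronglyMeasurable.integral_prod_right' (f := _) ?_)
    refine Measurable.stronglyMeasurable (Measurable.indicator ?_ ?_)
    · exact (hr.comp (measurable_snd.prodMk (hx.comp measurable_fst))).ennreal_toReal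
    · exact (measurableSet_lt (ha.comp measurable_fst) measurable_snd).inter
        (measurableSet_le measurable_snd (hb.comp measurable_fst))
  unfold survival intervalIntegral
  exact (Real.measurable_exp.comp ((key u t hu ht).sub (key t u ht hu)).neg).ennreal_ofReal

section FundamentalTheorem

variable {r : ℝ → ℝ≥0∞} {c : ℕ}

theorem intervalIntegrable_toReal_of_le (hr : Measurable r) (hc : ∀ s, r s ≤ c) (u t : ℝ) :
    IntervalIntegrable (fun s => (r s).toReal) volume u t := by
  refine (intervalIntegrable_const (c := (c : ℝ))).mono_fun
    hr.ennreal_toReal.aestronglyMeasurable (Filter.Eventually.of_forall fun s => ?_)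
  simpa using ENNReal.toReal_mono (by simp) (hc s)

/-- The fundamental theorem of calculus for `exp (σ ∫_u^s r)`. -/
theorem integral_toReal_mul_exp (hr : Measurable r) (hc : ∀ s, r s ≤ c) (σ u t : ℝ) :
    ∫ s in u..t, σ * ((r s).toReal * Real.exp (σ * ∫ v in u..s, (r v).toReal)) =
      Real.exp (σ * ∫ v in u..t, (r v).toReal) - 1 := by
  have hint := intervalIntegrable_toReal_of_le hr hc
  -- The rate is only measurable, so the primitive is differentiable merely almost everywhere. It is
  -- Lipschitz, and `exp` is Lipschitz on its compact range, so the composition is absolutely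
  -- continuous.
  have hLip : LipschitzWith c (fun s => ∫ v in u..s, (r v).toReal) := by
    refine LipschitzWith.of_dist_le_mul fun a b => ?_
    rw [dist_eq_norm, intervalIntegral.integral_interval_sub_left (hint u a) (hint u b),
      dist_eq_norm, Real.norm_eq_abs (a - b)]
    refine (intervalIntegral.norm_integral_le_of_norm_le_const (C := (c : ℝ)) fun s _ => ?_).trans
      (by simp)
    simpa using ENNReal.toReal_mono (by simp) (hc s)
  have hcont : Continuous (fun s => ∫ v in u..s, (r v).toReal) := hLip.continuous
  obtain ⟨M, hM⟩ := (isCompact_uIcc (a := u) (b := t)).exists_bound_of_continuousOn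
    hcont.continuousOn
  obtain ⟨L, hL⟩ := ContDiffOn.exists_lipschitzOnWith (n := 1)
    (f := fun y : ℝ => Real.exp (σ * y)) (s := Icc (-M) M)
    (by fun_prop) (by simp) (convex_Icc _ _) isCompact_Icc
  have hcomp := hL.comp (hLip.lipschitzOnWith (s := uIcc u t)) (fun s hs => by
    have := hM s hs
    rw [Real.norm_eq_abs, abs_le] at this
    exact this)
  have hFTC := hcomp.absolutelyContinuousOnInterval.integral_deriv_eq_sub
  simp only [Function.comp_apply, intervalIntegral.integral_same, mul_zero, Real.exp_zero] at hFTC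
  rw [← hFTC]
  refine intervalIntegral.integral_congr_ae ?_
  filter_upwards [(hint u t).ae_hasDerivAt_integral] with s hs hsm
  have := ((hs (uIoc_subset_uIcc hsm) u (by simp)).const_mul σ).exp
  refine Eq.trans ?_ this.deriv.symm
  ring

theorem lintegral_mul_ofReal_eq (hr : Measurable r) (hc : ∀ s, r s ≤ c) {u t : ℝ} (hut : u ≤ t)
    {g : ℝ → ℝ} (hg : Continuous g) (hg0 : ∀ s, 0 ≤ g s) :
    ∫⁻ s in Ioo u t, r s * ENNReal.ofReal (g s) =
      ENNReal.ofReal (∫ s in u..t, (r s).toReal * g s) := by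
  rw [Measure.restrict_congr_set Ioo_ae_eq_Ioc, intervalIntegral.integral_of_le hut,
    ofReal_integral_eq_lintegral_ofReal]
  · refine lintegral_congr fun s => ?_
    rw [ENNReal.ofReal_mul ENNReal.toReal_nonneg,
      ENNReal.ofReal_toReal ((hc s).trans_lt (by simp)).ne]
  · exact (intervalIntegrable_iff_integrableOn_Ioc_of_le hut).1
      ((intervalIntegrable_toReal_of_le hr hc u t).mul_continuousOn hg.continuousOn)
  · exact Filter.Eventually.of_forall fun s => mul_nonneg ENNReal.toReal_nonneg (hg0 s)

theorem continuous_primitive_toReal (hr : Measurable r) (hc : ∀ s, r s ≤ c) (u : ℝ) :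
    Continuous fun s => ∫ v in u..s, (r v).toReal :=
  intervalIntegral.continuous_primitive (intervalIntegrable_toReal_of_le hr hc) u

/-- Decomposition according to the time of the first event after `u`. -/
theorem lintegral_rate_mul_survival_first (hr : Measurable r) (hc : ∀ s, r s ≤ c) {u t : ℝ}
    (hut : u ≤ t) : survival r u t + ∫⁻ s in Ioo u t, r s * survival r u s = 1 := by
  have h1 := integral_toReal_mul_exp hr hc (-1) u t
  rw [intervalIntegral.integral_const_mul] at h1
  simp only [neg_one_mul] at h1
  unfold survival
  rw [lintegral_mul_ofReal_eq hr hc hut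
    (g := fun s => Real.exp (-∫ v in u..s, (r v).toReal))
    (Real.continuous_exp.comp (continuous_primitive_toReal hr hc u).neg)
    (fun s => (Real.exp_pos _).le), ← ENNReal.ofReal_add (Real.exp_pos _).le]
  · rw [show _ + _ = (1 : ℝ) by linarith, ENNReal.ofReal_one]
  · exact intervalIntegral.integral_nonneg hut
      fun _ _ => mul_nonneg ENNReal.toReal_nonneg (Real.exp_pos _).le

/-- Decomposition according to the time of the last event before `t`. -/
theorem lintegral_rate_mul_survival_last (hr : Measurable r) (hc : ∀ s, r s ≤ c) {u t : ℝ}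
    (hut : u ≤ t) : survival r u t + ∫⁻ s in Ioo u t, r s * survival r s t = 1 := by
  have hint := intervalIntegrable_toReal_of_le hr hc
  have h1 := integral_toReal_mul_exp hr hc 1 u t
  simp only [one_mul] at h1
  -- Splitting the integral at `s` isolates a constant factor and leaves the exponential with
  -- positive sign, covered by the case `σ = 1`.
  have h2 : ∀ s, survival r s t = ENNReal.ofReal (Real.exp (-∫ v in u..t, (r v).toReal) *
      Real.exp (∫ v in u..s, (r v).toReal)) := fun s => by
    rw [survival, ← Real.exp_add,
      ← intervalIntegral.integral_interval_sub_left (hint u t) (hint u s)]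
    ring_nf
  simp_rw [h2]
  rw [lintegral_mul_ofReal_eq hr hc hut
    (g := fun s => Real.exp (-∫ v in u..t, (r v).toReal) * Real.exp (∫ v in u..s, (r v).toReal))
    (continuous_const.mul (Real.continuous_exp.comp (continuous_primitive_toReal hr hc u)))
    (fun s => by positivity), ← ENNReal.ofReal_add (by positivity)]
  · simp only [mul_left_comm _ (Real.exp (-∫ v in u..t, (r v).toReal))]
    rw [intervalIntegral.integral_const_mul, h1, mul_sub, ← Real.exp_add]
    simp [← Real.exp_add]
  · exact intervalIntegral.integral_nonneg hut
      fun _ _ => mul_nonneg ENNReal.toReal_nonneg (by positivity)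

end FundamentalTheorem

/-! ### Jump counting measures and state distributions -/

open ProbabilityTheory

section JumpCounting

variable {X : Type*} [MeasurableSpace X]

/-- The probability that the state entered at time `p.1 < t` in `p = (time, state)` is not left
before `t`, for the jump kernel `K`. It vanishes for `t ≤ p.1`. -/
noncomputable def sojournWeight (K : Kernel (ℝ × X) X) (t : ℝ) (p : ℝ × X) : ℝ≥0∞ :=
  {p : ℝ × X | p.1 < t}.indicator (fun p => survival (fun s => K (s, p.2) univ) p.1 t) p

theorem sojournWeight_of_lt (K : Kernel (ℝ × X) X) {t : ℝ} {p : ℝ × X} (h : p.1 < t) :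
    sojournWeight K t p = survival (fun s => K (s, p.2) univ) p.1 t :=
  indicator_of_mem (show p ∈ {p : ℝ × X | p.1 < t} from h) _

theorem sojournWeight_of_le (K : Kernel (ℝ × X) X) {t : ℝ} {p : ℝ × X} (h : t ≤ p.1) :
    sojournWeight K t p = 0 :=
  indicator_of_notMem (show p ∉ {p : ℝ × X | p.1 < t} from not_lt.2 h) _

theorem sojournWeight_ne_top (K : Kernel (ℝ × X) X) (t : ℝ) (p : ℝ × X) :
    sojournWeight K t p ≠ ∞ := by
  rcases lt_or_ge p.1 t with h | h
  · rw [sojournWeight_of_lt K h]; exact survival_ne_top _ _ _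
  · rw [sojournWeight_of_le K h]; exact ENNReal.zero_ne_top

theorem measurable_sojournWeight_uncurry (K : Kernel (ℝ × X) X) :
    Measurable fun z : ℝ × ℝ × X => sojournWeight K z.1 z.2 := by
  have : (fun z : ℝ × ℝ × X => sojournWeight K z.1 z.2) =
      {z : ℝ × ℝ × X | z.2.1 < z.1}.indicator
        (fun z => survival (fun s => K (s, z.2.2) univ) z.2.1 z.1) := rfl
  rw [this]
  refine Measurable.indicator ?_ (measurableSet_lt (by fun_prop) (by fun_prop))
  exact measurable_survival (r := fun p => K p univ) (K.measurable_coe MeasurableSet.univ)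
    (by fun_prop) (by fun_prop) (by fun_prop)

@[fun_prop]
theorem measurable_sojournWeight (K : Kernel (ℝ × X) X) {Z : Type*} [MeasurableSpace Z]
    {t : Z → ℝ} {p : Z → ℝ × X} (ht : Measurable t) (hp : Measurable p) :
    Measurable fun z => sojournWeight K (t z) (p z) :=
  (measurable_sojournWeight_uncurry K).comp (ht.prodMk hp)

/-- From `p = (time, state)`, the measure of the times and places visited before the next jump. -/
noncomputable def sojourn (K : Kernel (ℝ × X) X) : Kernel (ℝ × X) (ℝ × X) :=
  (Kernel.withDensity (Kernel.const (ℝ × X) (volume : Measure ℝ))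
    (fun p t => sojournWeight K t p)) ×ₖ Kernel.deterministic Prod.snd measurable_snd

/-- Jump at the current time. -/
noncomputable def jump (K : Kernel (ℝ × X) X) : Kernel (ℝ × X) (ℝ × X) :=
  Kernel.deterministic Prod.fst measurable_fst ×ₖ K

/-- The distribution of time and place of the next jump. -/
noncomputable def nextJump (K : Kernel (ℝ × X) X) : Kernel (ℝ × X) (ℝ × X) :=
  jump K ∘ₖ sojourn K

/-- The distribution of the state at time `t`, if `Γ` is the measure counting the jumps. -/
noncomputable def stateAt (K : Kernel (ℝ × X) X) (Γ : Measure (ℝ × X)) [SFinite Γ] :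
    Kernel ℝ X :=
  (Kernel.withDensity (Kernel.const ℝ Γ) (fun t p => sojournWeight K t p)).map Prod.snd

variable (K : Kernel (ℝ × X) X)

instance isSFiniteKernel_withDensity_sojournWeight : IsSFiniteKernel
    (Kernel.withDensity (Kernel.const (ℝ × X) (volume : Measure ℝ))
      (fun p t => sojournWeight K t p)) :=
  Kernel.IsSFiniteKernel.withDensity _ fun _ _ => sojournWeight_ne_top _ _ _

instance : IsSFiniteKernel (sojourn K) := by unfold sojourn; infer_instance

instance : IsSFiniteKernel (jump K) := by unfold jump; infer_instance

instance : IsSFiniteKernel (nextJump K) := by unfold nextJump; infer_instance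

instance isSFiniteKernel_stateAt (Γ : Measure (ℝ × X)) [SFinite Γ] :
    IsSFiniteKernel (stateAt K Γ) := by
  have : IsSFiniteKernel (Kernel.withDensity (Kernel.const ℝ Γ)
      (fun t p => sojournWeight K t p)) :=
    Kernel.IsSFiniteKernel.withDensity _ fun _ _ => sojournWeight_ne_top _ _ _
  unfold stateAt; infer_instance

theorem lintegral_sojourn (p : ℝ × X) {f : ℝ × X → ℝ≥0∞} (hf : Measurable f) :
    ∫⁻ z, f z ∂(sojourn K p) = ∫⁻ t, sojournWeight K t p * f (t, p.2) := by
  rw [sojourn, Kernel.lintegral_prod_deterministic _ _ _ hf, Kernel.lintegral_withDensity,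
    Kernel.const_apply]
  · exact measurable_sojournWeight K measurable_snd measurable_fst
  · fun_prop

theorem lintegral_jump [IsSFiniteKernel K] (p : ℝ × X) {f : ℝ × X → ℝ≥0∞} (hf : Measurable f) :
    ∫⁻ z, f z ∂(jump K p) = ∫⁻ y, f (p.1, y) ∂(K p) := by
  rw [jump, Kernel.lintegral_deterministic_prod _ _ _ hf]

theorem lintegral_nextJump [IsSFiniteKernel K] (p : ℝ × X) {f : ℝ × X → ℝ≥0∞}
    (hf : Measurable f) : ∫⁻ z, f z ∂(nextJump K p) =
      ∫⁻ t, sojournWeight K t p * ∫⁻ y, f (t, y) ∂(K (t, p.2)) := by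
  rw [nextJump, Kernel.lintegral_comp _ _ _ hf, lintegral_sojourn K p hf.lintegral_kernel]
  simp_rw [lintegral_jump K _ hf]

theorem lintegral_stateAt (Γ : Measure (ℝ × X)) [SFinite Γ] (t : ℝ) {g : X → ℝ≥0∞}
    (hg : Measurable g) :
    ∫⁻ y, g y ∂(stateAt K Γ t) = ∫⁻ p, sojournWeight K t p * g p.2 ∂Γ := by
  rw [stateAt, Kernel.lintegral_map _ measurable_snd _ hg, Kernel.lintegral_withDensity,
    Kernel.const_apply]
  · exact measurable_sojournWeight K measurable_fst measurable_snd
  · fun_prop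

theorem stateAt_apply (Γ : Measure (ℝ × X)) [SFinite Γ] (t : ℝ) {B : Set X}
    (hB : MeasurableSet B) :
    stateAt K Γ t B = ∫⁻ p, sojournWeight K t p * B.indicator 1 p.2 ∂Γ := by
  rw [← lintegral_indicator_one hB, lintegral_stateAt K Γ t (measurable_one.indicator hB)]

theorem stateAt_mono {Γ Γ' : Measure (ℝ × X)} [SFinite Γ] [SFinite Γ'] (h : Γ ≤ Γ') (t : ℝ) :
    stateAt K Γ t ≤ stateAt K Γ' t := by
  refine Measure.le_iff.2 fun B hB => ?_
  rw [stateAt_apply K Γ t hB, stateAt_apply K Γ' t hB]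
  exact lintegral_mono' h le_rfl

/-- By Tonelli, the time spent in states after the entries `Γ` disintegrates over time into the
state distributions. This turns the integrals `P(s,dy) ds` of the forward equation into integrals
against `Γ`. -/
theorem sojourn_comp_eq (Γ : Measure (ℝ × X)) [SFinite Γ] :
    Γ.bind (sojourn K) = volume ⊗ₘ stateAt K Γ := by
  refine Measure.ext_of_lintegral _ fun f hf => ?_
  rw [Measure.lintegral_bind (Kernel.aemeasurable _) hf.aemeasurable, Measure.lintegral_compProd hf]
  simp_rw [lintegral_sojourn K _ hf]
  rw [lintegral_lintegral_swap (Measurable.aemeasurable (by fun_prop))]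
  refine lintegral_congr fun t => ?_
  rw [lintegral_stateAt K Γ t (by fun_prop)]

/-- The first-jump decomposition as a pointwise identity. -/
theorem sojournWeight_add_lintegral (hb : ∀ x, ∃ c : ℕ, ∀ s, K (s, x) univ ≤ c) (t : ℝ)
    (p : ℝ × X) :
    sojournWeight K t p + ∫⁻ s in Iio t, sojournWeight K s p * K (s, p.2) univ =
      (Iio t).indicator 1 p.1 := by
  obtain ⟨c, hc⟩ := hb p.2
  have hm : Measurable fun s => K (s, p.2) univ :=
    (K.measurable_coe MeasurableSet.univ).comp (by fun_prop)
  rcases lt_or_ge p.1 t with h | h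
  · rw [indicator_of_mem (mem_Iio.2 h), Pi.one_apply, sojournWeight_of_lt K h,
      ← lintegral_rate_mul_survival_first hm hc h.le]
    congr 1
    rw [← lintegral_indicator measurableSet_Iio, ← lintegral_indicator measurableSet_Ioo]
    refine lintegral_congr fun s => ?_
    by_cases hs : s ∈ Ioo p.1 t
    · rw [indicator_of_mem (show s ∈ Iio t from hs.2), indicator_of_mem hs,
        sojournWeight_of_lt K hs.1, mul_comm]
    · rw [indicator_of_notMem hs]
      by_cases hst : s < t
      · rw [indicator_of_mem (show s ∈ Iio t from hst), sojournWeight_of_le K, zero_mul]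
        exact not_lt.1 fun h' => hs ⟨h', hst⟩
      · rw [indicator_of_notMem (show s ∉ Iio t from hst)]
  · rw [indicator_of_notMem (notMem_Iio.2 h), sojournWeight_of_le K h, zero_add]
    refine setLIntegral_eq_zero measurableSet_Iio fun s hs => ?_
    rw [sojournWeight_of_le K ((mem_Iio.1 hs).le.trans h), zero_mul, Pi.zero_apply]

/-- The last-exit decomposition as a pointwise identity. -/
theorem sojournWeight_add_lintegral_last (hb : ∀ x, ∃ c : ℕ, ∀ s, K (s, x) univ ≤ c) (t : ℝ)
    (p : ℝ × X) :
    sojournWeight K t p +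
      ∫⁻ s, (Iio s).indicator 1 p.1 * (K (s, p.2) univ * sojournWeight K t (s, p.2)) =
      (Iio t).indicator 1 p.1 := by
  obtain ⟨c, hc⟩ := hb p.2
  have hm : Measurable fun s => K (s, p.2) univ :=
    (K.measurable_coe MeasurableSet.univ).comp (by fun_prop)
  rcases lt_or_ge p.1 t with h | h
  · rw [indicator_of_mem (mem_Iio.2 h), Pi.one_apply, sojournWeight_of_lt K h,
      ← lintegral_rate_mul_survival_last hm hc h.le]
    congr 1
    rw [← lintegral_indicator measurableSet_Ioo]
    refine lintegral_congr fun s => ?_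
    by_cases hs : s ∈ Ioo p.1 t
    · rw [indicator_of_mem (show p.1 ∈ Iio s from hs.1), indicator_of_mem hs,
        sojournWeight_of_lt K hs.2, Pi.one_apply, one_mul]
    · rw [indicator_of_notMem hs]
      by_cases hst : s < t
      · rw [indicator_of_notMem (fun h' : p.1 ∈ Iio s => hs ⟨h', hst⟩), zero_mul]
      · rw [sojournWeight_of_le K (not_lt.1 hst), mul_zero, mul_zero]
  · rw [indicator_of_notMem (notMem_Iio.2 h), sojournWeight_of_le K h, zero_add]
    refine lintegral_eq_zero_of_ae_eq_zero (Filter.Eventually.of_forall fun s => ?_)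
    simp only [Pi.zero_apply]
    rcases lt_or_ge p.1 s with hs | hs
    · rw [sojournWeight_of_le K (p := (s, p.2)) (h.trans hs.le), mul_zero, mul_zero]
    · rw [indicator_of_notMem (notMem_Iio.2 hs), zero_mul]

/-- Every state entered in `B` before `t` either survives until `t` or is left before `t`. -/
theorem stateAt_add_outflow (hb : ∀ x, ∃ c : ℕ, ∀ s, K (s, x) univ ≤ c)
    (Γ : Measure (ℝ × X)) [SFinite Γ] (t : ℝ) {B : Set X} (hB : MeasurableSet B) :
    stateAt K Γ t B + ∫⁻ p in Iio t ×ˢ B, K p univ ∂(volume ⊗ₘ stateAt K Γ) =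
      Γ (Iio t ×ˢ B) := by
  have hI : MeasurableSet (Iio t ×ˢ B) := measurableSet_Iio.prod hB
  have hK : Measurable fun p => K p univ := K.measurable_coe MeasurableSet.univ
  rw [← sojourn_comp_eq, ← lintegral_indicator hI, Measure.lintegral_bind (Kernel.aemeasurable _)
    (hK.indicator hI).aemeasurable, stateAt_apply K Γ t hB, ← lintegral_add_left,
    ← lintegral_indicator_one hI]
  · classical
    refine lintegral_congr fun p => ?_
    rw [lintegral_sojourn K p (hK.indicator hI)]
    have : (Iio t ×ˢ B).indicator 1 p = ((Iio t).indicator 1 p.1 : ℝ≥0∞) * B.indicator 1 p.2 := by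
      simp only [indicator_apply, mem_prod, Pi.one_apply]
      split_ifs <;> simp_all
    rw [this, ← sojournWeight_add_lintegral K hb, add_mul, ← lintegral_indicator measurableSet_Iio,
      ← lintegral_mul_const]
    · congr 1
      refine lintegral_congr fun s => ?_
      simp only [indicator_apply, mem_prod, Pi.one_apply]
      split_ifs <;> simp_all
    · refine Measurable.indicator (Measurable.mul (by fun_prop) (hK.comp (by fun_prop)))
        measurableSet_Iio
  · exact Measurable.mul (by fun_prop) ((measurable_one.indicator hB).comp measurable_snd)

theorem jump_comp_apply [IsSFiniteKernel K] (m : Measure (ℝ × X)) (t : ℝ) {B : Set X}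
    (hB : MeasurableSet B) :
    m.bind (jump K) (Iio t ×ˢ B) = ∫⁻ p in Iio t ×ˢ univ, K p B ∂m := by
  have hI : MeasurableSet (Iio t ×ˢ B) := measurableSet_Iio.prod hB
  rw [← lintegral_indicator_one hI, Measure.lintegral_bind (Kernel.aemeasurable _)
    (measurable_one.indicator hI).aemeasurable, ← lintegral_indicator
    (measurableSet_Iio.prod MeasurableSet.univ)]
  classical
  refine lintegral_congr fun p => ?_
  rw [lintegral_jump K p (measurable_one.indicator hI)]
  by_cases hp : p.1 < t
  · rw [indicator_of_mem (show p ∈ Iio t ×ˢ univ from ⟨hp, mem_univ _⟩), ← lintegral_indicator_one hB]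
    refine lintegral_congr fun y => ?_
    simp [indicator_apply, hp]
  · rw [indicator_of_notMem (fun h : p ∈ Iio t ×ˢ univ => hp h.1)]
    simp [hp]

theorem bind_nextJump (m : Measure (ℝ × X)) [SFinite m] :
    m.bind (nextJump K) = (volume ⊗ₘ stateAt K m).bind (jump K) := by
  rw [← sojourn_comp_eq, nextJump, Measure.comp_assoc]

theorem indicator_eq_one_mul {α : Type*} (s : Set α) (f : α → ℝ≥0∞) (a : α) :
    s.indicator f a = s.indicator 1 a * f a := by
  by_cases h : a ∈ s <;> simp [h]

/-- The distribution of time and place of the `n`-th jump, started from `μ`. -/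
noncomputable def nthJump (μ : Measure (ℝ × X)) (n : ℕ) : Measure (ℝ × X) :=
  (fun m => m.bind (nextJump K))^[n] μ

theorem nthJump_succ (μ : Measure (ℝ × X)) (n : ℕ) :
    nthJump K μ (n + 1) = (nthJump K μ n).bind (nextJump K) :=
  Function.iterate_succ_apply' _ _ _

theorem nthJump_succ_eq_nthJump_bind (μ : Measure (ℝ × X)) (n : ℕ) :
    nthJump K μ (n + 1) = nthJump K (μ.bind (nextJump K)) n :=
  Function.iterate_succ_apply _ _ _

instance sFinite_nthJump (μ : Measure (ℝ × X)) [SFinite μ] (n : ℕ) : SFinite (nthJump K μ n) := by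
  induction n with
  | zero => exact ‹SFinite μ›
  | succ n ih => rw [nthJump_succ]; infer_instance

/-- The measure counting all jumps, the start included as the `0`-th one. -/
noncomputable def allJumps (μ : Measure (ℝ × X)) : Measure (ℝ × X) :=
  Measure.sum (nthJump K μ)

instance (μ : Measure (ℝ × X)) [SFinite μ] : SFinite (allJumps K μ) := by
  unfold allJumps; infer_instance

/-- Renewal identity: everything after the start is the next jump after an earlier entry. -/
theorem allJumps_eq (μ : Measure (ℝ × X)) :
    allJumps K μ = μ + (allJumps K μ).bind (nextJump K) := by
  rw [allJumps, Measure.bind_sum _ _ (Kernel.aemeasurable _)]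
  simp_rw [← nthJump_succ]
  ext s hs
  rw [Measure.add_apply, Measure.sum_apply _ hs, Measure.sum_apply _ hs,
    tsum_eq_zero_add' ENNReal.summable]
  rfl

/-! ### Balance equations and domination of the minimal flow -/

/-- The forward balance equation for `κ` at time `t` on the set `B`: the mass in `B` plus the mass
that left `B` equals the mass that entered `B`. -/
def Balanced (Γ : Measure (ℝ × X)) (κ : Kernel ℝ X) (t : ℝ) (B : Set X) : Prop :=
  κ t B + ∫⁻ p in Iio t ×ˢ B, K p univ ∂(volume ⊗ₘ κ) = Γ (Iio t ×ˢ B)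

/-- The entries of a flow of distributions `κ` started from `μ`. -/
noncomputable def entries (μ : Measure (ℝ × X)) (κ : Kernel ℝ X) : Measure (ℝ × X) :=
  μ + (volume ⊗ₘ κ).bind (jump K)

instance (μ : Measure (ℝ × X)) [SFinite μ] (κ : Kernel ℝ X) : SFinite (entries K μ κ) := by
  unfold entries; infer_instance

theorem entries_stateAt_allJumps (μ : Measure (ℝ × X)) [SFinite μ] :
    entries K μ (stateAt K (allJumps K μ)) = allJumps K μ := by
  rw [entries, ← bind_nextJump, ← allJumps_eq]

theorem balanced_stateAt_allJumps (hb : ∀ x, ∃ c : ℕ, ∀ s, K (s, x) univ ≤ c)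
    (μ : Measure (ℝ × X)) [SFinite μ] (t : ℝ) {B : Set X} (hB : MeasurableSet B) :
    Balanced K (entries K μ (stateAt K (allJumps K μ))) (stateAt K (allJumps K μ)) t B := by
  rw [Balanced, stateAt_add_outflow K hb _ t hB, entries_stateAt_allJumps]

theorem stateAt_allJumps_apply (μ : Measure (ℝ × X)) [SFinite μ] (t : ℝ) {B : Set X}
    (hB : MeasurableSet B) :
    stateAt K (allJumps K μ) t B = ∑' n, stateAt K (nthJump K μ n) t B := by
  simp_rw [stateAt_apply K _ t hB, allJumps]
  rw [lintegral_sum_measure]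

theorem stateAt_nthJump_add [IsSFiniteKernel K] (hb : ∀ x, ∃ c : ℕ, ∀ s, K (s, x) univ ≤ c)
    (μ : Measure (ℝ × X)) [SFinite μ] (n : ℕ) (t : ℝ) :
    stateAt K (nthJump K μ n) t univ + nthJump K μ (n + 1) (Iio t ×ˢ univ) =
      nthJump K μ n (Iio t ×ˢ univ) := by
  rw [nthJump_succ, bind_nextJump, jump_comp_apply K _ t MeasurableSet.univ,
    stateAt_add_outflow K hb _ t MeasurableSet.univ]

/-- The mass entering with jump `n` before `t` splits into the part still there at `t` and the part
making jump `n + 1` before `t`; the sum over `n` telescopes. -/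
theorem stateAt_allJumps_univ_le [IsSFiniteKernel K] (hb : ∀ x, ∃ c : ℕ, ∀ s, K (s, x) univ ≤ c)
    (μ : Measure (ℝ × X)) [SFinite μ] (t : ℝ) : stateAt K (allJumps K μ) t univ ≤ μ univ := by
  rw [stateAt_allJumps_apply K μ t MeasurableSet.univ]
  have key : ∀ m, ∑ n ∈ Finset.range m, stateAt K (nthJump K μ n) t univ +
      nthJump K μ m (Iio t ×ˢ univ) = μ (Iio t ×ˢ univ) := by
    intro m
    induction m with
    | zero => rw [Finset.sum_range_zero, zero_add]; rfl
    | succ m ih => rw [Finset.sum_range_succ, add_assoc, stateAt_nthJump_add K hb, ih]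
  refine ENNReal.tsum_le_of_sum_range_le fun m => ?_
  calc _ ≤ _ := le_self_add
    _ = _ := key m
    _ ≤ _ := measure_mono (subset_univ _)

/-- Balance on all measurable subsets of `B` is an equality of measures on `B`, so it extends to
nonnegative functions of the state. The additive form needs no finiteness. -/
theorem Balanced.lintegral {Γ : Measure (ℝ × X)} {κ : Kernel ℝ X} {t : ℝ} {B : Set X}
    (hB : MeasurableSet B) (h : ∀ C ⊆ B, MeasurableSet C → Balanced K Γ κ t C) {g : X → ℝ≥0∞}
    (hg : Measurable g) :
    ∫⁻ y in B, g y ∂κ t + ∫⁻ p in Iio t ×ˢ B, g p.2 * K p univ ∂(volume ⊗ₘ κ) =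
      ∫⁻ p in Iio t ×ˢ B, g p.2 ∂Γ := by
  have hK : Measurable fun p => K p univ := K.measurable_coe MeasurableSet.univ
  have hfs : ∀ {f : X → ℝ≥0∞}, Measurable f → Measurable fun p : ℝ × X => f p.2 :=
    fun hf => hf.comp measurable_snd
  have hfK : ∀ {f : X → ℝ≥0∞}, Measurable f → Measurable fun p : ℝ × X => f p.2 * K p univ :=
    fun hf => (hfs hf).mul hK
  refine Measurable.ennreal_induction (motive := fun g => ∫⁻ y in B, g y ∂κ t +
    ∫⁻ p in Iio t ×ˢ B, g p.2 * K p univ ∂(volume ⊗ₘ κ) = ∫⁻ p in Iio t ×ˢ B, g p.2 ∂Γ)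
    (fun c C hC => ?_) (fun f g _ hf hg ihf ihg => ?_) (fun f hf hmono ih => ?_) hg
  · have hp : ∀ p : ℝ × X, C.indicator (fun _ => c) p.2 =
      (Prod.snd ⁻¹' C).indicator (fun _ => c) p := fun p => rfl
    have hpK : ∀ p : ℝ × X, C.indicator (fun _ => c) p.2 * K p univ =
        (Prod.snd ⁻¹' C).indicator (fun p => c * K p univ) p := fun p => by
      rw [hp, indicator_mul_left]
    have hC' : MeasurableSet (Prod.snd ⁻¹' C : Set (ℝ × X)) := measurable_snd hC
    have hset : Prod.snd ⁻¹' C ∩ Iio t ×ˢ B = Iio t ×ˢ (C ∩ B) := by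
      ext p; simp only [mem_inter_iff, mem_preimage, mem_prod]; tauto
    simp_rw [hpK]
    simp_rw [hp]
    rw [lintegral_indicator hC, lintegral_indicator hC', lintegral_indicator hC',
      lintegral_const, lintegral_const_mul _ hK, lintegral_const,
      Measure.restrict_restrict hC, Measure.restrict_restrict hC', hset,
      Measure.restrict_restrict hC', hset, Measure.restrict_apply_univ,
      Measure.restrict_apply_univ, ← mul_add,
      h (C ∩ B) inter_subset_right (hC.inter hB)]
  · simp only [Pi.add_apply, add_mul]
    rw [lintegral_add_left hf, lintegral_add_left (hfK hf),
      lintegral_add_left (hfs hf), add_add_add_comm, ihf, ihg]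
  · simp only [ENNReal.iSup_mul]
    rw [lintegral_iSup hf hmono, lintegral_iSup (fun n => hfK (hf n))
      (fun i j hij p => mul_le_mul_left (hmono hij p.2) _),
      lintegral_iSup (fun n => hfs (hf n)) (fun i j hij p => hmono hij p.2),
      ENNReal.iSup_add_iSup_of_monotone]
    · exact iSup_congr ih
    · exact fun i j hij => lintegral_mono (hmono hij)
    · exact fun i j hij => lintegral_mono fun p => mul_le_mul_left (hmono hij p.2) _

/-- If the flow `κ` is balanced on all subsets of `B` before time `t`, then what left `B`
before `t` and what entered `B` and survived until `t` add up to what entered `B` before `t`. -/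
theorem stateAt_add_outflow_of_balanced (hb : ∀ x, ∃ c : ℕ, ∀ s, K (s, x) univ ≤ c)
    (Γ : Measure (ℝ × X)) [SFinite Γ] (κ : Kernel ℝ X) [IsSFiniteKernel κ] (t : ℝ) {B : Set X}
    (hB : MeasurableSet B)
    (h : ∀ᵐ s, s < t → (∀ y, K (s, y) univ = 0) ∨
      ∀ C ⊆ B, MeasurableSet C → Balanced K Γ κ s C) :
    stateAt K Γ t B + ∫⁻ p in Iio t ×ˢ B, K p univ ∂(volume ⊗ₘ κ) = Γ (Iio t ×ˢ B) := by
  have hK : Measurable fun p => K p univ := K.measurable_coe MeasurableSet.univ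
  have hB1 : Measurable (B.indicator (1 : X → ℝ≥0∞)) := measurable_one.indicator hB
  have hI : Measurable fun z : ℝ × ℝ × X => (Iio z.1).indicator (1 : ℝ → ℝ≥0∞) z.2.1 := by
    have : (fun z : ℝ × ℝ × X => (Iio z.1).indicator (1 : ℝ → ℝ≥0∞) z.2.1) =
        {z : ℝ × ℝ × X | z.2.1 < z.1}.indicator 1 := rfl
    rw [this]
    exact measurable_one.indicator (measurableSet_lt (by fun_prop) (by fun_prop))
  have hprod : ∀ (s : ℝ) (p : ℝ × X),
      (Iio s ×ˢ B).indicator 1 p = ((Iio s).indicator 1 p.1 : ℝ≥0∞) * B.indicator 1 p.2 := by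
    classical
    intro s p
    simp only [indicator_apply, mem_prod, Pi.one_apply]
    split_ifs <;> simp_all
  have hset : ∀ (m : Measure (ℝ × X)) (s : ℝ) (f : ℝ × X → ℝ≥0∞),
      ∫⁻ p in Iio s ×ˢ B, f p ∂m =
        ∫⁻ p, (Iio s).indicator 1 p.1 * B.indicator 1 p.2 * f p ∂m := by
    intro m s f
    rw [← lintegral_indicator (measurableSet_Iio.prod hB)]
    refine lintegral_congr fun p => ?_
    rw [← hprod, ← indicator_eq_one_mul]
  -- The density of a last event at time `s` in state `y`, with none from `s` to `t`. Balance at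
  -- time `s` is tested against `g s` and then integrated over `s`; the last-exit identity collapses
  -- both sides.
  let g : ℝ → X → ℝ≥0∞ := fun s y => K (s, y) univ * sojournWeight K t (s, y)
  have hg : Measurable fun p : ℝ × X => g p.1 p.2 :=
    (hK.comp (by fun_prop)).mul (by fun_prop)
  have hgs : ∀ s, Measurable (g s) := fun s => hg.comp measurable_prodMk_left
  have hbal : ∀ᵐ s, ∫⁻ p in Iio s ×ˢ B, g s p.2 ∂Γ =
      ∫⁻ y in B, g s y ∂κ s + ∫⁻ p in Iio s ×ˢ B, g s p.2 * K p univ ∂(volume ⊗ₘ κ) := by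
    filter_upwards [h] with s hs
    have hzero : (∀ y, g s y = 0) → ∫⁻ p in Iio s ×ˢ B, g s p.2 ∂Γ = ∫⁻ y in B, g s y ∂κ s +
        ∫⁻ p in Iio s ×ˢ B, g s p.2 * K p univ ∂(volume ⊗ₘ κ) := fun h0 => by simp [h0]
    rcases lt_or_ge s t with hst | hst
    · rcases hs hst with h0 | hC
      · exact hzero fun y => by simp [g, h0]
      · exact (Balanced.lintegral K hB hC (hgs s)).symm
    · exact hzero fun y => by simp [g, sojournWeight_of_le K (p := (s, y)) hst]
  have hlast : ∀ p : ℝ × X, (Iio t).indicator 1 p.1 = sojournWeight K t p +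
      ∫⁻ s, (Iio s).indicator 1 p.1 * g s p.2 :=
    fun p => (sojournWeight_add_lintegral_last K hb t p).symm
  have hm1 : ∀ p : ℝ × X, Measurable fun s => (Iio s).indicator (1 : ℝ → ℝ≥0∞) p.1 * g s p.2 :=
    fun p => (hI.comp (by fun_prop : Measurable fun s => (s, p))).mul
      (hg.comp (by fun_prop : Measurable fun s => (s, p.2)))
  have hm2 : Measurable fun z : ℝ × ℝ × X =>
      (Iio z.1).indicator (1 : ℝ → ℝ≥0∞) z.2.1 * g z.1 z.2.2 :=
    hI.mul (hg.comp (by fun_prop : Measurable fun z : ℝ × ℝ × X => (z.1, z.2.2)))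
  have hB2 : Measurable fun z : ℝ × ℝ × X => B.indicator (1 : X → ℝ≥0∞) z.2.2 :=
    hB1.comp (by fun_prop)
  have hBg : Measurable fun p : ℝ × X => B.indicator (1 : X → ℝ≥0∞) p.2 * g p.1 p.2 :=
    (hB1.comp measurable_snd).mul hg
  have hG : Γ (Iio t ×ˢ B) = stateAt K Γ t B + ∫⁻ s, ∫⁻ p in Iio s ×ˢ B, g s p.2 ∂Γ := by
    simp_rw [hset]
    rw [lintegral_lintegral_swap, stateAt_apply K Γ t hB, ← lintegral_add_left,
      ← lintegral_indicator_one (measurableSet_Iio.prod hB)]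
    · refine lintegral_congr fun p => ?_
      rw [hprod, hlast, add_mul, ← lintegral_mul_const _ (hm1 p)]
      congr 1
      exact lintegral_congr fun s => by ring
    · exact Measurable.mul (by fun_prop) (hB1.comp measurable_snd)
    · refine Measurable.aemeasurable ?_
      have := hm2.mul hB2
      convert this using 1
      funext z
      simp only [Function.uncurry, Pi.mul_apply]
      ring
  rw [hG, lintegral_congr_ae hbal, lintegral_add_left]
  · congr 1
    have h1 : ∫⁻ s, ∫⁻ y in B, g s y ∂κ s =
        ∫⁻ p, B.indicator 1 p.2 * g p.1 p.2 ∂(volume ⊗ₘ κ) := by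
      rw [Measure.lintegral_compProd hBg]
      refine lintegral_congr fun s => ?_
      rw [← lintegral_indicator hB]
      refine lintegral_congr fun y => ?_
      rw [indicator_eq_one_mul]
    rw [h1, hset]
    simp_rw [hset]
    rw [lintegral_lintegral_swap, ← lintegral_add_left]
    · refine lintegral_congr fun p => ?_
      rw [hlast]
      have : ∀ s, (Iio s).indicator 1 p.1 * B.indicator 1 p.2 * (g s p.2 * K p univ) =
          ((Iio s).indicator 1 p.1 * g s p.2) * (B.indicator 1 p.2 * K p univ) :=
        fun s => by ring
      simp_rw [this]
      rw [lintegral_mul_const _ (hm1 p)]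
      simp only [g]
      ring
    · exact hBg
    · refine Measurable.aemeasurable ?_
      have := (hm2.mul hB2).mul (hK.comp (by fun_prop : Measurable fun z : ℝ × ℝ × X => z.2))
      convert this using 1
      funext z
      simp only [Function.uncurry, Pi.mul_apply, Function.comp]
      ring
  · have := Measurable.lintegral_kernel_prod_right (κ := κ.restrict hB)
      (f := g) hg
    simpa only [Kernel.restrict_apply] using this

/-- A flow which is reproduced by its own entries dominates the minimal one. -/
theorem allJumps_le_entries [IsSFiniteKernel K] (μ : Measure (ℝ × X)) [SFinite μ] (κ : Kernel ℝ X)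
    [IsSFiniteKernel κ]
    (h : ∀ᵐ s, (∀ y, K (s, y) univ = 0) ∨ stateAt K (entries K μ κ) s = κ s) :
    allJumps K μ ≤ entries K μ κ := by
  -- The entries depend on `κ` only through its jumps, so `κ s` may be replaced by `stateAt` of the
  -- entries wherever the rates do not vanish.
  have hN : entries K μ κ = μ + (entries K μ κ).bind (nextJump K) := by
    rw [bind_nextJump]
    nth_rw 1 [entries]
    congr 1
    refine Measure.ext_of_lintegral _ fun f hf => ?_
    rw [Measure.lintegral_bind (Kernel.aemeasurable _) hf.aemeasurable,
      Measure.lintegral_bind (Kernel.aemeasurable _) hf.aemeasurable,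
      Measure.lintegral_compProd hf.lintegral_kernel,
      Measure.lintegral_compProd hf.lintegral_kernel]
    refine lintegral_congr_ae ?_
    filter_upwards [h] with s hs
    rcases hs with hs | hs
    · have h0 : ∀ y, ∫⁻ z, f z ∂(jump K (s, y)) = 0 := fun y => by
        rw [lintegral_jump K _ hf, Measure.measure_univ_eq_zero.1 (hs y), lintegral_zero_measure]
      simp [h0]
    · rw [hs]
  have key : ∀ (n : ℕ) (f : ℝ × X → ℝ≥0∞), Measurable f →
      ∑ k ∈ Finset.range n, ∫⁻ p, f p ∂(nthJump K μ k) ≤ ∫⁻ p, f p ∂(entries K μ κ) := by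
    intro n
    induction n with
    | zero => intro f _; simp
    | succ n ih =>
      intro f hf
      -- Generation zero is matched with `μ`; later generations follow from the induction hypothesis
      -- for `f` averaged over one next jump.
      rw [Finset.sum_range_succ', hN, lintegral_add_measure, add_comm,
        Measure.lintegral_bind (Kernel.aemeasurable _) hf.aemeasurable]
      refine add_le_add le_rfl ?_
      simp_rw [nthJump_succ]
      refine le_trans (le_of_eq ?_) (ih _ hf.lintegral_kernel)
      exact Finset.sum_congr rfl fun k _ =>
        Measure.lintegral_bind (Kernel.aemeasurable _) hf.aemeasurable
  refine Measure.le_iff.2 fun s hs => ?_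
  rw [allJumps, Measure.sum_apply _ hs]
  refine ENNReal.tsum_le_of_sum_range_le fun n => ?_
  simpa [lintegral_indicator_one hs] using key n (s.indicator 1) (measurable_one.indicator hs)

end JumpCounting

/-! ### S-finite kernels and measurability of sections -/

section Kernels

variable {α β : Type*} [MeasurableSpace α] [MeasurableSpace β]

/-- The parameter space is cut according to the integer part of the total mass, which makes each
piece uniformly bounded. -/
theorem isSFiniteKernel_of_lt_top (κ : Kernel α β) (h : ∀ a, κ a univ < ∞) :
    IsSFiniteKernel κ := by
  classical
  have hf : Measurable fun a => ⌊(κ a univ).toReal⌋₊ :=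
    Nat.measurable_floor.comp (κ.measurable_coe MeasurableSet.univ).ennreal_toReal
  have hs : ∀ n : ℕ, MeasurableSet {a | ⌊(κ a univ).toReal⌋₊ = n} :=
    fun n => hf (measurableSet_singleton n)
  have hfin : ∀ n, IsFiniteKernel (Kernel.piecewise (hs n) κ 0) := fun n => by
    refine ⟨(n : ℝ≥0∞) + 1, by simp, fun a => ?_⟩
    rw [Kernel.piecewise_apply]
    split_ifs with ha
    · rw [← ENNReal.ofReal_toReal (h a).ne]
      have := (Nat.lt_floor_add_one (κ a univ).toReal).le
      rw [show ⌊(κ a univ).toReal⌋₊ = n from ha] at this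
      refine (ENNReal.ofReal_le_ofReal this).trans (le_of_eq ?_)
      rw [ENNReal.ofReal_add (by positivity) zero_le_one, ENNReal.ofReal_natCast,
        ENNReal.ofReal_one]
    · simp
  have hsum : κ = Kernel.sum fun n => Kernel.piecewise (hs n) κ 0 := by
    ext a B hB
    rw [Kernel.sum_apply' _ _ hB, tsum_eq_single ⌊(κ a univ).toReal⌋₊]
    · rw [Kernel.piecewise_apply, if_pos (by simp)]
    · intro n hn
      rw [Kernel.piecewise_apply, if_neg (by simpa using hn.symm)]
      simp
  rw [hsum]
  exact Kernel.isSFiniteKernel_sum (hκs := fun n => inferInstance)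

theorem isSFiniteKernel_of_cover (κ : Kernel α β) {A : ℕ → Set β} (hA : ∀ n, MeasurableSet (A n))
    (hcov : ⋃ n, A n = univ) (h : ∀ a n, κ a (A n) < ∞) : IsSFiniteKernel κ := by
  have hD : ∀ n, MeasurableSet (disjointed A n) := fun n => MeasurableSet.disjointed hA n
  have hsum : κ = Kernel.sum fun n => κ.restrict (hD n) := by
    ext a B hB
    rw [Kernel.sum_apply]
    simp_rw [Kernel.restrict_apply]
    rw [← Measure.restrict_iUnion (disjoint_disjointed A) hD, iUnion_disjointed, hcov,
      Measure.restrict_univ]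
  rw [hsum]
  refine Kernel.isSFiniteKernel_sum (hκs := fun n => isSFiniteKernel_of_lt_top _ fun a => ?_)
  rw [Kernel.restrict_apply, Measure.restrict_apply_univ]
  exact (measure_mono (disjointed_subset A n)).trans_lt (h a n)

/-- A π-λ argument from rectangles. It is needed because the set `B \ {x}` in the jump rates moves
with the parameter `x`. -/
theorem measurable_signedMeasure_section (f : α → SignedMeasure β)
    (hf : ∀ B, MeasurableSet B → Measurable fun a => f a B) {C : Set (α × β)}
    (hC : MeasurableSet C) : Measurable fun a => f a (Prod.mk a ⁻¹' C) := by
  have hsec : ∀ {C : Set (α × β)}, MeasurableSet C → ∀ a, MeasurableSet (Prod.mk a ⁻¹' C) :=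
    fun hC a => measurable_prodMk_left hC
  induction C, hC using MeasurableSpace.induction_on_inter generateFrom_prod.symm
    isPiSystem_prod with
  | empty => simp
  | basic C hC =>
    obtain ⟨A, hA, B, hB, rfl⟩ := hC
    have : (fun a => f a (Prod.mk a ⁻¹' A ×ˢ B)) = A.indicator fun a => f a B := by
      funext a
      by_cases ha : a ∈ A <;> simp [ha]
    rw [this]
    exact (hf B hB).indicator hA
  | compl C hC ih =>
    have : (fun a => f a (Prod.mk a ⁻¹' Cᶜ)) = fun a => f a univ - f a (Prod.mk a ⁻¹' C) := by
      funext a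
      rw [preimage_compl, VectorMeasure.of_compl (hsec hC a)]
    rw [this]
    exact (hf univ MeasurableSet.univ).sub ih
  | iUnion C hdisj hC ih =>
    have hs : ∀ a, HasSum (fun n => f a (Prod.mk a ⁻¹' C n)) (f a (Prod.mk a ⁻¹' ⋃ n, C n)) :=
      fun a => by
        rw [preimage_iUnion]
        exact (f a).m_iUnion (fun n => hsec (hC n) a)
          fun i j hij => (hdisj hij).preimage _
    exact measurable_of_tendsto_metrizable
      (fun n => Finset.measurable_sum (Finset.range n) fun i _ => ih i)
      (tendsto_pi_nhds.2 fun a => (hs a).tendsto_sum_nat)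

end Kernels

/-! ### Time domains and the jump kernel of a `Q`-function -/

theorem measurableSet_timeDomain (T₀ : ℝ) (T₁ : EReal) : MeasurableSet (timeDomain T₀ T₁) :=
  (measurableSet_le measurable_const measurable_id).inter
    (measurableSet_lt measurable_coe_real_ereal measurable_const)

theorem measurableSet_openTimeDomain (T₀ : ℝ) (T₁ : EReal) :
    MeasurableSet (openTimeDomain T₀ T₁) :=
  (measurableSet_lt measurable_const measurable_id).inter
    (measurableSet_lt measurable_coe_real_ereal measurable_const)

theorem openTimeDomain_subset (T₀ : ℝ) (T₁ : EReal) :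
    openTimeDomain T₀ T₁ ⊆ timeDomain T₀ T₁ := fun _ h => ⟨h.1.le, h.2⟩

theorem mem_timeDomain_of_le {T₀ : ℝ} {T₁ : EReal} {s t : ℝ} (hs : T₀ ≤ s) (hst : s ≤ t)
    (ht : t ∈ timeDomain T₀ T₁) : s ∈ timeDomain T₀ T₁ :=
  ⟨hs, (EReal.coe_le_coe_iff.2 hst).trans_lt ht.2⟩

theorem mem_openTimeDomain_of_le {T₀ : ℝ} {T₁ : EReal} {s t : ℝ} (hs : T₀ < s) (hst : s ≤ t)
    (ht : t ∈ openTimeDomain T₀ T₁) : s ∈ openTimeDomain T₀ T₁ :=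
  ⟨hs, (EReal.coe_le_coe_iff.2 hst).trans_lt ht.2⟩

theorem setLIntegral_Iio_eq_Ioo {T t : ℝ} {f : ℝ → ℝ≥0∞} (hf : ∀ s < T, f s = 0) :
    ∫⁻ s in Iio t, f s = ∫⁻ s in Ioo T t, f s := by
  rw [← lintegral_indicator measurableSet_Iio, ← lintegral_indicator measurableSet_Ioo]
  refine lintegral_congr_ae ?_
  have : ∀ᵐ s : ℝ, s ≠ T := by simp [ae_iff]
  filter_upwards [this] with s hs
  rcases hs.lt_or_gt with h | h
  · simp [indicator_apply, hf s h]
  · simp [indicator_apply, h]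

variable {X : Type*} [MeasurableSpace X] {T₀ : ℝ} {T₁ : EReal} {q : X → ℝ → SignedMeasure X}

theorem IsQBounded.subset {B C : Set X} (hB : IsQBounded T₀ T₁ q B) (hCB : C ⊆ B)
    (hC : MeasurableSet C) : IsQBounded T₀ T₁ q C :=
  let ⟨c, hc⟩ := hB.2
  ⟨hC, c, fun y hy => hc y (hCB hy)⟩

theorem outflow_lt_top {P : ℝ → Measure X} {t : ℝ} (ht : t ∈ openTimeDomain T₀ T₁)
    (hP : ∀ s ∈ openTimeDomain T₀ T₁, P s univ ≤ 1) {B : Set X} (hB : IsQBounded T₀ T₁ q B) :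
    outflow T₀ q P t B < ∞ := by
  obtain ⟨c, hc⟩ := hB.2
  calc outflow T₀ q P t B ≤ ∫⁻ _ in Ioo T₀ t, ENNReal.ofReal c := by
        refine setLIntegral_mono measurable_const fun s hs => ?_
        have hsO := mem_openTimeDomain_of_le hs.1 hs.2.le ht
        calc ∫⁻ y in B, ENNReal.ofReal (rate q y s) ∂(P s)
            ≤ ∫⁻ _ in B, ENNReal.ofReal c ∂(P s) :=
              setLIntegral_mono measurable_const fun y hy => ENNReal.ofReal_le_ofReal
                (hc y hy s (openTimeDomain_subset _ _ hsO))
          _ = ENNReal.ofReal c * P s B := setLIntegral_const _ _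
          _ ≤ ENNReal.ofReal c * 1 := by
              gcongr
              exact (measure_mono (subset_univ B)).trans (hP s hsO)
          _ = ENNReal.ofReal c := mul_one _
    _ < ∞ := by
        rw [setLIntegral_const, Real.volume_Ioo]
        exact ENNReal.mul_lt_top ENNReal.ofReal_lt_top ENNReal.ofReal_lt_top

open Classical in
/-- A solution of the forward equation as a kernel, extended by zero to all times. -/
noncomputable def IsForwardSolution.kernel {x : X} {P : ℝ → Measure X}
    (hP : IsForwardSolution T₀ T₁ q x P) : Kernel ℝ X where
  toFun t := if t ∈ openTimeDomain T₀ T₁ then P t else 0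
  measurable' := by
    refine Measure.measurable_of_measurable_coe _ fun B hB => ?_
    refine measurable_of_restrict_of_restrict_compl (measurableSet_openTimeDomain T₀ T₁) ?_ ?_
    · refine Eq.mp (congrArg Measurable ?_) (hP.measurable B hB)
      funext t
      rw [domRestrict_apply, if_pos t.2]
    · refine Eq.mp (congrArg Measurable ?_) (measurable_const (a := (0 : ℝ≥0∞)))
      funext t
      rw [domRestrict_apply, if_neg t.2]
      rfl

theorem IsForwardSolution.kernel_apply {x : X} {P : ℝ → Measure X}
    (hP : IsForwardSolution T₀ T₁ q x P) {t : ℝ} (ht : t ∈ openTimeDomain T₀ T₁) :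
    hP.kernel t = P t :=
  if_pos ht

variable [StandardBorelSpace X]

theorem IsConservativeQFunction.measurable_diff_singleton (hq : IsConservativeQFunction T₀ T₁ q)
    {B : Set X} (hB : MeasurableSet B) :
    Measurable fun p : X × timeDomain T₀ T₁ => q p.1 (p.2 : ℝ) (B \ {p.1}) := by
  let := upgradeStandardBorel X
  -- The sections of `C` are `B \ {x}`; `C` is measurable because the diagonal of a standard Borel
  -- space is.
  refine measurable_signedMeasure_section (fun p : X × timeDomain T₀ T₁ => q p.1 (p.2 : ℝ))
    hq.measurable (C := {z | z.2 ∈ B} \ {z | z.2 = z.1.1}) ?_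
  exact (measurable_snd hB).diff
    (measurableSet_eq_fun measurable_snd (measurable_fst.comp measurable_fst))

open Classical in
/-- The jump measures `q(x,t,· \ {x})` as a kernel, extended by zero to all times. -/
noncomputable def jumpKernel (hq : IsConservativeQFunction T₀ T₁ q) : Kernel (ℝ × X) X where
  toFun p := if p.1 ∈ timeDomain T₀ T₁ then jumpMeasure q p.2 p.1 else 0
  measurable' := by
    refine Measure.measurable_of_measurable_coe _ fun B hB => ?_
    refine measurable_of_restrict_of_restrict_compl
      (measurable_fst (measurableSet_timeDomain T₀ T₁)) ?_ ?_
    · have : ((Prod.fst ⁻¹' timeDomain T₀ T₁).domRestrict fun p : ℝ × X =>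
          (if p.1 ∈ timeDomain T₀ T₁ then jumpMeasure q p.2 p.1 else 0) B) =
          fun p => ENNReal.ofReal (q p.1.2 p.1.1 (B \ {p.1.2})) := by
        funext p
        rw [domRestrict_apply, if_pos (show p.1.1 ∈ timeDomain T₀ T₁ from p.2),
          jumpMeasure_apply hq _ p.2 hB]
      rw [this]
      exact ((hq.measurable_diff_singleton hB).comp
        ((measurable_snd.comp measurable_subtype_coe).prodMk
          ((measurable_fst.comp measurable_subtype_coe).subtype_mk
            (h := fun p => p.2)))).ennreal_ofReal
    · have : ((Prod.fst ⁻¹' timeDomain T₀ T₁)ᶜ.domRestrict fun p : ℝ × X =>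
          (if p.1 ∈ timeDomain T₀ T₁ then jumpMeasure q p.2 p.1 else 0) B) = fun _ => 0 := by
        funext p
        rw [domRestrict_apply, if_neg (show p.1.1 ∉ timeDomain T₀ T₁ from p.2)]
        rfl
      rw [this]
      exact measurable_const

theorem jumpKernel_of_mem (hq : IsConservativeQFunction T₀ T₁ q) {t : ℝ} (x : X)
    (ht : t ∈ timeDomain T₀ T₁) : jumpKernel hq (t, x) = jumpMeasure q x t :=
  if_pos ht

theorem jumpKernel_of_notMem (hq : IsConservativeQFunction T₀ T₁ q) {t : ℝ} (x : X)
    (ht : t ∉ timeDomain T₀ T₁) : jumpKernel hq (t, x) = 0 :=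
  if_neg ht

theorem jumpKernel_apply (hq : IsConservativeQFunction T₀ T₁ q) {t : ℝ} (x : X)
    (ht : t ∈ timeDomain T₀ T₁) {B : Set X} (hB : MeasurableSet B) :
    jumpKernel hq (t, x) B = ENNReal.ofReal (q x t (B \ {x})) := by
  rw [jumpKernel_of_mem hq x ht, jumpMeasure_apply hq x ht hB]

theorem jumpKernel_univ (hq : IsConservativeQFunction T₀ T₁ q) {t : ℝ} (x : X)
    (ht : t ∈ timeDomain T₀ T₁) : jumpKernel hq (t, x) univ = ENNReal.ofReal (rate q x t) :=
  jumpKernel_apply hq x ht MeasurableSet.univ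

theorem jumpKernel_univ_toReal (hq : IsConservativeQFunction T₀ T₁ q) {t : ℝ} (x : X)
    (ht : t ∈ timeDomain T₀ T₁) : (jumpKernel hq (t, x) univ).toReal = rate q x t := by
  rw [jumpKernel_univ hq x ht, ENNReal.toReal_ofReal]
  exact hq.nonneg_off_diag x t ht univ MeasurableSet.univ

theorem jumpKernel_bounded (hq : IsConservativeQFunction T₀ T₁ q) (hLB : BoundedRates T₀ T₁ q)
    (x : X) : ∃ c : ℕ, ∀ s, jumpKernel hq (s, x) univ ≤ c := by
  obtain ⟨b, hb⟩ := hLB x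
  refine ⟨⌈b⌉₊, fun s => ?_⟩
  by_cases hs : s ∈ timeDomain T₀ T₁
  · rw [jumpKernel_univ hq x hs, ← ENNReal.ofReal_natCast]
    exact ENNReal.ofReal_le_ofReal ((hb (mem_image_of_mem _ hs)).trans (Nat.le_ceil b))
  · rw [jumpKernel_of_notMem hq x hs]
    simp

instance isSFiniteKernel_jumpKernel (hq : IsConservativeQFunction T₀ T₁ q) :
    IsSFiniteKernel (jumpKernel hq) := by
  refine isSFiniteKernel_of_lt_top _ fun p => ?_
  by_cases hs : p.1 ∈ timeDomain T₀ T₁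
  · rw [show p = (p.1, p.2) from rfl, jumpKernel_univ hq p.2 hs]
    exact ENNReal.ofReal_lt_top
  · rw [show p = (p.1, p.2) from rfl, jumpKernel_of_notMem hq p.2 hs]
    simp

/-- The state space is a countable union of `q`-bounded sets. -/
theorem exists_isQBounded_cover (hq : IsConservativeQFunction T₀ T₁ q)
    (hLB : BoundedRates T₀ T₁ q) :
    ∃ A : ℕ → Set X, (∀ n, IsQBounded T₀ T₁ q (A n)) ∧ ⋃ n, A n = univ := by
  obtain ⟨A, hA, hbd, hcov⟩ := exists_measurable_cover_of_bounded_sections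
    ((jumpKernel hq).measurable_coe MeasurableSet.univ) (jumpKernel_bounded hq hLB)
  refine ⟨A, fun n => ⟨hA n, n, fun y hy t ht => ?_⟩, hcov⟩
  have := hbd n y hy t
  rw [jumpKernel_univ hq y ht, ← ENNReal.ofReal_natCast] at this
  exact (ENNReal.ofReal_le_ofReal_iff (Nat.cast_nonneg n)).1 this

theorem sojournWeight_jumpKernel (hq : IsConservativeQFunction T₀ T₁ q) {u t : ℝ} (x : X)
    (hu : u ∈ timeDomain T₀ T₁) (ht : t ∈ timeDomain T₀ T₁) (hut : u < t) :
    sojournWeight (jumpKernel hq) t (u, x) =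
      ENNReal.ofReal (Real.exp (-∫ s in u..t, rate q x s)) := by
  rw [sojournWeight_of_lt _ (p := (u, x)) hut, survival]
  congr 3
  refine intervalIntegral.integral_congr fun s hs => ?_
  rw [uIcc_of_le hut.le] at hs
  exact jumpKernel_univ_toReal hq x (mem_timeDomain_of_le (hu.1.trans hs.1) hs.2 ht)

/-! ### Feller's series as expectations over successive jumps -/

section Feller

variable {Y : Type*} [MeasurableSpace Y] (K : Kernel (ℝ × Y) Y)

/-- The expectation of `f` at the `n`-th jump as a function of the start. -/
noncomputable def expectNthJump (n : ℕ) (f : ℝ × Y → ℝ≥0∞) : ℝ × Y → ℝ≥0∞ :=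
  (fun f p => ∫⁻ z, f z ∂(nextJump K p))^[n] f

theorem expectNthJump_succ (n : ℕ) (f : ℝ × Y → ℝ≥0∞) (p : ℝ × Y) :
    expectNthJump K (n + 1) f p = ∫⁻ z, expectNthJump K n f z ∂(nextJump K p) := by
  rw [expectNthJump, Function.iterate_succ_apply']
  rfl

theorem measurable_expectNthJump (n : ℕ) {f : ℝ × Y → ℝ≥0∞} (hf : Measurable f) :
    Measurable (expectNthJump K n f) := by
  induction n with
  | zero => exact hf
  | succ n ih =>
    rw [show expectNthJump K (n + 1) f = _ from funext (expectNthJump_succ K n f)]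
    exact ih.lintegral_kernel

/-- Duality between appending jumps to a law and conditioning on the first jump; the latter is the
form of Feller's recursion. -/
theorem lintegral_nthJump (μ : Measure (ℝ × Y)) (n : ℕ) {f : ℝ × Y → ℝ≥0∞} (hf : Measurable f) :
    ∫⁻ p, f p ∂(nthJump K μ n) = ∫⁻ p, expectNthJump K n f p ∂μ := by
  induction n generalizing μ with
  | zero => rfl
  | succ n ih =>
    rw [nthJump_succ_eq_nthJump_bind, ih, Measure.lintegral_bind (Kernel.aemeasurable _)
      (measurable_expectNthJump K n hf).aemeasurable]
    simp_rw [expectNthJump_succ]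

/-- Jumps only move forward in time. This cuts the time integral off at `t`, as in Feller's terms.
-/
theorem expectNthJump_eq_zero [IsSFiniteKernel K] {t : ℝ} {f : ℝ × Y → ℝ≥0∞} (hf : Measurable f)
    (h0 : ∀ p, t ≤ p.1 → f p = 0) (n : ℕ) {p : ℝ × Y} (hp : t ≤ p.1) :
    expectNthJump K n f p = 0 := by
  induction n generalizing p with
  | zero => exact h0 p hp
  | succ n ih =>
    rw [expectNthJump_succ, lintegral_nextJump K p (measurable_expectNthJump K n hf)]
    refine lintegral_eq_zero_of_ae_eq_zero (Filter.Eventually.of_forall fun s => ?_)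
    simp only [Pi.zero_apply]
    rcases lt_or_ge p.1 s with hs | hs
    · have : ∀ y, expectNthJump K n f (s, y) = 0 := fun y => ih (p := (s, y)) (hp.trans hs.le)
      simp [this]
    · rw [sojournWeight_of_le K hs, zero_mul]

end Feller

theorem fellerTerm_eq_expectNthJump (hq : IsConservativeQFunction T₀ T₁ q) {t : ℝ}
    (ht : t ∈ timeDomain T₀ T₁) {B : Set X} (hB : MeasurableSet B) (n : ℕ) {u : ℝ} (x : X)
    (hu : u ∈ timeDomain T₀ T₁) (hut : u < t) :
    fellerTerm q n u x t B = expectNthJump (jumpKernel hq) n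
      (fun p => sojournWeight (jumpKernel hq) t p * B.indicator 1 p.2) (u, x) := by
  have hf : Measurable fun p : ℝ × X =>
      sojournWeight (jumpKernel hq) t p * B.indicator 1 p.2 :=
    Measurable.mul (by fun_prop) ((measurable_one.indicator hB).comp measurable_snd)
  have h0 : ∀ p : ℝ × X, t ≤ p.1 →
      sojournWeight (jumpKernel hq) t p * B.indicator 1 p.2 = 0 := fun p hp => by
    rw [sojournWeight_of_le _ hp, zero_mul]
  induction n generalizing u x with
  | zero =>
    change B.indicator _ x = sojournWeight (jumpKernel hq) t (u, x) * B.indicator 1 x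
    rw [sojournWeight_jumpKernel hq x hu ht hut]
    by_cases hx : x ∈ B <;> simp [hx]
  | succ n ih =>
    rw [expectNthJump_succ, lintegral_nextJump _ _ (measurable_expectNthJump _ n hf), fellerTerm,
      ← lintegral_indicator measurableSet_Ioo]
    refine lintegral_congr fun w => ?_
    by_cases hw : w ∈ Ioo u t
    · have hwD := mem_timeDomain_of_le (hu.1.trans hw.1.le) hw.2.le ht
      rw [indicator_of_mem hw, sojournWeight_jumpKernel hq x hu hwD hw.1,
        jumpKernel_of_mem hq x hwD, ← lintegral_const_mul]
      · exact lintegral_congr fun y => by rw [ih y hwD hw.2]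
      · exact (measurable_expectNthJump _ n hf).comp measurable_prodMk_left
    · rw [indicator_of_notMem hw]
      rcases le_or_gt w u with hwu | hwu
      · rw [sojournWeight_of_le _ (p := (u, x)) hwu, zero_mul]
      · have htw : t ≤ w := not_lt.1 fun h => hw ⟨hwu, h⟩
        have : ∀ y, expectNthJump (jumpKernel hq) n
            (fun p => sojournWeight (jumpKernel hq) t p * B.indicator 1 p.2) (w, y) = 0 :=
          fun y => expectNthJump_eq_zero _ hf h0 n (p := (w, y)) htw
        simp [this]

theorem fellerTransition_eq_stateAt (hq : IsConservativeQFunction T₀ T₁ q) {u t : ℝ} (x : X)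
    (hu : u ∈ timeDomain T₀ T₁) (ht : t ∈ timeDomain T₀ T₁) (hut : u < t) {B : Set X}
    (hB : MeasurableSet B) :
    fellerTransition q u x t B =
      stateAt (jumpKernel hq) (allJumps (jumpKernel hq) (Measure.dirac (u, x))) t B := by
  have hf : Measurable fun p : ℝ × X =>
      sojournWeight (jumpKernel hq) t p * B.indicator 1 p.2 :=
    Measurable.mul (by fun_prop) ((measurable_one.indicator hB).comp measurable_snd)
  rw [fellerTransition, stateAt_allJumps_apply _ _ t hB]
  refine tsum_congr fun n => ?_
  rw [fellerTerm_eq_expectNthJump hq ht hB n x hu hut, stateAt_apply _ _ t hB,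
    lintegral_nthJump _ _ n hf, lintegral_dirac' _ (measurable_expectNthJump _ n hf)]

/-! ### The forward equation: existence, minimality and uniqueness -/

theorem setLIntegral_jumpKernel_univ (hq : IsConservativeQFunction T₀ T₁ q) {P : ℝ → Measure X}
    {κ : Kernel ℝ X} [IsSFiniteKernel κ] (hκ : ∀ s ∈ openTimeDomain T₀ T₁, κ s = P s) {t : ℝ}
    (ht : t ∈ openTimeDomain T₀ T₁) {B : Set X} (hB : MeasurableSet B) :
    ∫⁻ p in Iio t ×ˢ B, jumpKernel hq p univ ∂(volume ⊗ₘ κ) = outflow T₀ q P t B := by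
  rw [Measure.setLIntegral_compProd ((jumpKernel hq).measurable_coe MeasurableSet.univ)
    measurableSet_Iio hB, setLIntegral_Iio_eq_Ioo (T := T₀), outflow]
  · refine setLIntegral_congr_fun measurableSet_Ioo fun s hs => ?_
    have hsO := mem_openTimeDomain_of_le hs.1 hs.2.le ht
    simp only [hκ s hsO]
    exact lintegral_congr fun y => jumpKernel_univ hq y (openTimeDomain_subset _ _ hsO)
  · intro s hs
    simp [jumpKernel_of_notMem hq _ fun h : s ∈ timeDomain T₀ T₁ => hs.not_ge h.1]

theorem setLIntegral_jumpKernel (hq : IsConservativeQFunction T₀ T₁ q) {P : ℝ → Measure X}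
    {κ : Kernel ℝ X} [IsSFiniteKernel κ] (hκ : ∀ s ∈ openTimeDomain T₀ T₁, κ s = P s) {t : ℝ}
    (ht : t ∈ openTimeDomain T₀ T₁) {B : Set X} (hB : MeasurableSet B) :
    ∫⁻ p in Iio t ×ˢ univ, jumpKernel hq p B ∂(volume ⊗ₘ κ) = inflow T₀ q P t B := by
  rw [Measure.setLIntegral_compProd ((jumpKernel hq).measurable_coe hB)
    measurableSet_Iio MeasurableSet.univ, setLIntegral_Iio_eq_Ioo (T := T₀), inflow]
  · refine setLIntegral_congr_fun measurableSet_Ioo fun s hs => ?_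
    have hsO := mem_openTimeDomain_of_le hs.1 hs.2.le ht
    simp only [hκ s hsO, Measure.restrict_univ]
    exact lintegral_congr fun y => jumpKernel_apply hq y (openTimeDomain_subset _ _ hsO) hB
  · intro s hs
    simp [jumpKernel_of_notMem hq _ fun h : s ∈ timeDomain T₀ T₁ => hs.not_ge h.1]

/-- The subtraction-free form of the forward equation: the entries before `t` into `B` are the
start, if in `B`, plus the inflow. -/
theorem balanced_entries_iff (hq : IsConservativeQFunction T₀ T₁ q) (x : X) {P : ℝ → Measure X}
    {κ : Kernel ℝ X} [IsSFiniteKernel κ] (hκ : ∀ s ∈ openTimeDomain T₀ T₁, κ s = P s) {t : ℝ}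
    (ht : t ∈ openTimeDomain T₀ T₁) {B : Set X} (hB : MeasurableSet B) :
    Balanced (jumpKernel hq) (entries (jumpKernel hq) (Measure.dirac (T₀, x)) κ) κ t B ↔
      P t B + outflow T₀ q P t B = B.indicator 1 x + inflow T₀ q P t B := by
  have hd : Measure.dirac (T₀, x) (Iio t ×ˢ B) = B.indicator 1 x := by
    rw [Measure.dirac_apply' _ (measurableSet_Iio.prod hB)]
    by_cases hx : x ∈ B <;> simp [hx, ht.1]
  rw [Balanced, entries, Measure.add_apply, jump_comp_apply _ _ t hB, hd,
    setLIntegral_jumpKernel_univ hq hκ ht hB, setLIntegral_jumpKernel hq hκ ht hB, hκ t ht]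

theorem ForwardEquation.balanced (hq : IsConservativeQFunction T₀ T₁ q) {x : X}
    {P : ℝ → Measure X} {κ : Kernel ℝ X} [IsSFiniteKernel κ]
    (hκ : ∀ s ∈ openTimeDomain T₀ T₁, κ s = P s) {t : ℝ} (ht : t ∈ openTimeDomain T₀ T₁)
    {B : Set X} (hB : MeasurableSet B) (h : ForwardEquation T₀ q x P t B) :
    Balanced (jumpKernel hq) (entries (jumpKernel hq) (Measure.dirac (T₀, x)) κ) κ t B := by
  obtain ⟨h1, h2, h3, h4⟩ := h
  rw [balanced_entries_iff hq x hκ ht hB]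
  have hx : B.indicator (1 : X → ℝ≥0∞) x = ENNReal.ofReal (B.indicator (fun _ => (1 : ℝ)) x) := by
    by_cases hx : x ∈ B <;> simp [hx]
  have hx0 : 0 ≤ B.indicator (fun _ => (1 : ℝ)) x := indicator_nonneg (fun _ _ => zero_le_one) x
  rw [hx, ← ENNReal.ofReal_toReal h1.ne, ← ENNReal.ofReal_toReal h2.ne,
    ← ENNReal.ofReal_toReal h3.ne, ← ENNReal.ofReal_add ENNReal.toReal_nonneg
    ENNReal.toReal_nonneg, ← ENNReal.ofReal_add hx0 ENNReal.toReal_nonneg, h4]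
  congr 1
  ring

theorem Balanced.forwardEquation (hq : IsConservativeQFunction T₀ T₁ q) {x : X}
    {P : ℝ → Measure X} {κ : Kernel ℝ X} [IsSFiniteKernel κ]
    (hκ : ∀ s ∈ openTimeDomain T₀ T₁, κ s = P s) {t : ℝ} (ht : t ∈ openTimeDomain T₀ T₁)
    {B : Set X} (hB : MeasurableSet B) (hfin : P t B < ∞) (hout : outflow T₀ q P t B < ∞)
    (h : Balanced (jumpKernel hq) (entries (jumpKernel hq) (Measure.dirac (T₀, x)) κ) κ t B) :
    ForwardEquation T₀ q x P t B := by
  rw [balanced_entries_iff hq x hκ ht hB] at h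
  -- Finiteness of the inflow comes from the balance itself, whose other side is finite.
  have hin : inflow T₀ q P t B < ∞ :=
    lt_of_le_of_lt le_add_self (h ▸ ENNReal.add_lt_top.2 ⟨hfin, hout⟩)
  refine ⟨hfin, hin, hout, ?_⟩
  have hx : B.indicator (fun _ => (1 : ℝ)) x = (B.indicator (1 : X → ℝ≥0∞) x).toReal := by
    by_cases hx : x ∈ B <;> simp [hx]
  have hxt : B.indicator (1 : X → ℝ≥0∞) x ≠ ∞ := by
    by_cases hx : x ∈ B <;> simp [hx]
  rw [hx, eq_sub_iff_add_eq, ← ENNReal.toReal_add hfin.ne hout.ne, h,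
    ENNReal.toReal_add hxt hin.ne]

/-- Feller's transition function satisfies the forward equation. -/
theorem isForwardSolution_stateAt (hq : IsConservativeQFunction T₀ T₁ q)
    (hLB : BoundedRates T₀ T₁ q) (x : X) :
    IsForwardSolution T₀ T₁ q x
      (stateAt (jumpKernel hq) (allJumps (jumpKernel hq) (Measure.dirac (T₀, x)))) := by
  have hle : ∀ t, stateAt (jumpKernel hq) (allJumps (jumpKernel hq) (Measure.dirac (T₀, x))) t
      univ ≤ 1 := fun t =>
    (stateAt_allJumps_univ_le _ (jumpKernel_bounded hq hLB) _ t).trans (by simp)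
  refine ⟨fun B hB => (Kernel.measurable_coe _ hB).comp measurable_subtype_coe,
    fun t ht B hB => ?_⟩
  exact (balanced_stateAt_allJumps _ (jumpKernel_bounded hq hLB) _ t hB.1).forwardEquation hq
    (fun _ _ => rfl) ht hB.1 (((measure_mono (subset_univ B)).trans (hle t)).trans_lt
    ENNReal.one_lt_top) (outflow_lt_top ht (fun s _ => hle s) hB)

/-- A solution may have infinite total mass, but the equation forces finite mass on each `q`-bounded
set of the cover. -/
theorem IsForwardSolution.isSFiniteKernel (hq : IsConservativeQFunction T₀ T₁ q)
    (hLB : BoundedRates T₀ T₁ q) {x : X} {P : ℝ → Measure X}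
    (hP : IsForwardSolution T₀ T₁ q x P) : IsSFiniteKernel hP.kernel := by
  obtain ⟨A, hA, hcov⟩ := exists_isQBounded_cover hq hLB
  refine isSFiniteKernel_of_cover _ (fun n => (hA n).1) hcov fun t n => ?_
  by_cases ht : t ∈ openTimeDomain T₀ T₁
  · rw [hP.kernel_apply ht]
    exact (hP.equation t ht _ (hA n)).1
  · rw [show hP.kernel t = 0 from if_neg ht]
    simp

/-- A solution of the forward equation is the state distribution generated by its own entries. -/
theorem IsForwardSolution.stateAt_entries (hq : IsConservativeQFunction T₀ T₁ q)
    (hLB : BoundedRates T₀ T₁ q) {x : X} {P : ℝ → Measure X}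
    (hP : IsForwardSolution T₀ T₁ q x P) {t : ℝ} (ht : t ∈ openTimeDomain T₀ T₁) :
    stateAt (jumpKernel hq) (entries (jumpKernel hq) (Measure.dirac (T₀, x)) hP.kernel) t =
      P t := by
  have := hP.isSFiniteKernel hq hLB
  have hκ : ∀ s ∈ openTimeDomain T₀ T₁, hP.kernel s = P s := fun s hs => hP.kernel_apply hs
  have hbal : ∀ s ∈ openTimeDomain T₀ T₁, ∀ B, IsQBounded T₀ T₁ q B →
      Balanced (jumpKernel hq) (entries (jumpKernel hq) (Measure.dirac (T₀, x)) hP.kernel)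
        hP.kernel s B :=
    fun s hs B hB => (hP.equation s hs B hB).balanced hq hκ hs hB.1
  have key : ∀ B, IsQBounded T₀ T₁ q B → stateAt (jumpKernel hq)
      (entries (jumpKernel hq) (Measure.dirac (T₀, x)) hP.kernel) t B = P t B := by
    intro B hB
    have h1 := stateAt_add_outflow_of_balanced (jumpKernel hq) (jumpKernel_bounded hq hLB)
      (entries (jumpKernel hq) (Measure.dirac (T₀, x)) hP.kernel) hP.kernel t hB.1 (by
        have : ∀ᵐ s : ℝ, s ≠ T₀ := by simp [ae_iff]
        filter_upwards [this] with s hs hst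
        rcases hs.lt_or_gt with h | h
        · left
          intro y
          rw [jumpKernel_of_notMem hq y fun h' : s ∈ timeDomain T₀ T₁ => h.not_ge h'.1]
          rfl
        · right
          exact fun C hCB hC => hbal s (mem_openTimeDomain_of_le h hst.le ht) C
            (hB.subset hCB hC))
    -- Both identities now have the same right-hand side and the same outflow, which is finite and
    -- cancels.
    rw [← hbal t ht B hB, hκ t ht, setLIntegral_jumpKernel_univ hq hκ ht hB.1] at h1
    exact (ENNReal.add_left_inj (hP.equation t ht B hB).2.2.1.ne).1 h1
  obtain ⟨A, hA, hcov⟩ := exists_isQBounded_cover hq hLB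
  refine (Measure.ext_iff_of_iUnion_eq_univ hcov).2 fun n => Measure.ext fun C hC => ?_
  rw [Measure.restrict_apply hC, Measure.restrict_apply hC]
  exact key _ ((hA n).subset inter_subset_right (hC.inter (hA n).1))

/-- Feller's transition function is the minimal solution of the forward equation. -/
theorem IsForwardSolution.stateAt_le (hq : IsConservativeQFunction T₀ T₁ q)
    (hLB : BoundedRates T₀ T₁ q) {x : X} {P : ℝ → Measure X}
    (hP : IsForwardSolution T₀ T₁ q x P) {t : ℝ} (ht : t ∈ openTimeDomain T₀ T₁) :
    stateAt (jumpKernel hq) (allJumps (jumpKernel hq) (Measure.dirac (T₀, x))) t ≤ P t := by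
  have := hP.isSFiniteKernel hq hLB
  rw [← hP.stateAt_entries hq hLB ht]
  refine stateAt_mono _ (allJumps_le_entries _ _ _ ?_) t
  -- At `T₀` the rates may be positive while the extended solution is zero, so this single time is
  -- discarded as a null set.
  have : ∀ᵐ s : ℝ, s ≠ T₀ := by simp [ae_iff]
  filter_upwards [this] with s hs
  by_cases hsO : s ∈ openTimeDomain T₀ T₁
  · right
    rw [hP.stateAt_entries hq hLB hsO, hP.kernel_apply hsO]
  · left
    intro y
    rw [jumpKernel_of_notMem hq y fun h => hsO ⟨lt_of_le_of_ne h.1 hs.symm, h.2⟩]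
    rfl

end JumpMarkov

theorem corollary3p2 {X : Type*} [MeasurableSpace X] [StandardBorelSpace X]
    (T₀ : ℝ) (T₁ : EReal) (hT : (T₀ : EReal) < T₁)
    (q : X → ℝ → SignedMeasure X) (hq : JumpMarkov.IsConservativeQFunction T₀ T₁ q)
    (hLB : JumpMarkov.BoundedRates T₀ T₁ q) (x : X) :
    -- `Pbar t` is the set function `P̄(t, ·) = P̄(T₀, x; t, ·)`, which is a measure
    ∃ Pbar : ℝ → Measure X,
      (∀ t ∈ JumpMarkov.openTimeDomain T₀ T₁, ∀ B, MeasurableSet B →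
        Pbar t B = JumpMarkov.fellerTransition q T₀ x t B) ∧
      -- with values in `[0,1]`
      (∀ t ∈ JumpMarkov.openTimeDomain T₀ T₁, ∀ B, MeasurableSet B → Pbar t B ≤ 1) ∧
      -- it satisfies the equation for all `t` and all `q`-bounded sets
      JumpMarkov.IsForwardSolution T₀ T₁ q x Pbar ∧
      -- it is the minimal solution
      (∀ P : ℝ → Measure X, JumpMarkov.IsForwardSolution T₀ T₁ q x P →
        ∀ t ∈ JumpMarkov.openTimeDomain T₀ T₁, ∀ B, MeasurableSet B → Pbar t B ≤ P t B) ∧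
      -- if its total mass is one, it is the unique solution with values in `[0,1]`
      ((∀ t ∈ JumpMarkov.openTimeDomain T₀ T₁, Pbar t univ = 1) →
        ∀ P : ℝ → Measure X, JumpMarkov.IsForwardSolution T₀ T₁ q x P →
          (∀ t ∈ JumpMarkov.openTimeDomain T₀ T₁, ∀ B, MeasurableSet B → P t B ≤ 1) →
          ∀ t ∈ JumpMarkov.openTimeDomain T₀ T₁, ∀ B, MeasurableSet B → P t B = Pbar t B) := by
  have hmin : ∀ P : ℝ → Measure X, JumpMarkov.IsForwardSolution T₀ T₁ q x P →
      ∀ t ∈ JumpMarkov.openTimeDomain T₀ T₁, ∀ B, MeasurableSet B →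
        JumpMarkov.stateAt (JumpMarkov.jumpKernel hq) (JumpMarkov.allJumps
          (JumpMarkov.jumpKernel hq) (Measure.dirac (T₀, x))) t B ≤ P t B :=
    fun P hP t ht B _ => hP.stateAt_le hq hLB ht B
  refine ⟨JumpMarkov.stateAt (JumpMarkov.jumpKernel hq) (JumpMarkov.allJumps
    (JumpMarkov.jumpKernel hq) (Measure.dirac (T₀, x))), fun t ht B hB => ?_, fun t _ B _ => ?_,
    JumpMarkov.isForwardSolution_stateAt hq hLB x, hmin, fun h1 P hP hP1 t ht B hB => ?_⟩
  · exact (JumpMarkov.fellerTransition_eq_stateAt hq x ⟨le_rfl, hT⟩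
      (JumpMarkov.openTimeDomain_subset _ _ ht) ht.1 hB).symm
  · refine (measure_mono (subset_univ B)).trans ((JumpMarkov.stateAt_allJumps_univ_le _
      (JumpMarkov.jumpKernel_bounded hq hLB) _ t).trans ?_)
    simp
  · refine le_antisymm ?_ (hmin P hP t ht B hB)
    -- The upper bound on `B` comes from minimality on the complement: `P` has mass at most 1, the
    -- full mass of the minimal solution.
    have hfin : P t Bᶜ ≠ ∞ := ((hP1 t ht _ hB.compl).trans_lt ENNReal.one_lt_top).ne
    refine (ENNReal.add_le_add_iff_right hfin).1 ?_
    rw [measure_add_measure_compl hB]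
    refine (hP1 t ht univ MeasurableSet.univ).trans ?_
    rw [← h1 t ht, ← measure_add_measure_compl hB]
    exact add_le_add le_rfl (hmin P hP t ht _ hB.compl)
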